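/- Let $(X,d)$ be a metric space and let $\mu$ be a Borel measure on $X$ with $0<\mu(B(x,r))<\infty$ for all $x\in X$, $r\in(0,\infty)$, where $B(x,r)$ is the open ball. Notation. $\mathcal P_b(X)$ is the set of measurable $p:X\to(0,\infty)$ with $\operatorname{ess\,inf}p>0$ and $\operatorname{ess\,sup}p<\infty$. $\mathcal P_b^{\log}(X)$ is the set of $p\in\mathcal P_b(X)$ for which there is $C>0$ with $\left|\frac1{p(x)}-\frac1{p(y)}\right|\le \frac{C}{\log(e+1/d(x,y))}$ for all $x\ne y$ in $X$. We write $q\gg p$ (or $p\ll q$) if $\operatorname{ess\,inf}(q-p)>0$. For $p\in\mathcal P_b(X)$, $L^{p(\cdot)}(X,\mu)$ is the space of measurable $u:X\to\mathbb R$ with $\int_X|u|^{p(x)}\,d\mu<\infty$, with the quasi-norm $\|u\|_{L^{p(\cdot)}}=\inf\{\lambda>0:\int_X|u/\lambda|^{p(x)}\,d\mu\le1\}$. For $s,p\in\mathcal P_b(X)$, $M^{s(\cdot),p(\cdot)}(X,d,\mu)$ is the space of $u\in L^{p(\cdot)}(X,\mu)$ for which $\|u\|_{M^{s(\cdot),p(\cdot)}}:=\|u\|_{L^{p(\cdot)}}+\inf_g\|g\|_{L^{p(\cdot)}}<\infty$,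 where the infimum (with $\inf\emptyset=\infty$) is over all measurable $g:X\to[0,\infty]$ such that, for some $\mu$-null set $N$, $|u(x)-u(y)|\le d(x,y)^{s(x)}g(x)+d(x,y)^{s(y)}g(y)$ for all $x,y\in X\setminus N$. For bounded $\alpha:X\to[0,\infty)$, $C^{0,\alpha(\cdot)}(X,d)$ is the space of bounded continuous $u:X\to\mathbb R$ with finite norm $\sup_X|u|+\sup_{x\ne y}\frac{|u(x)-u(y)|}{d(x,y)^{\alpha(x)}}$. Functions equal $\mu$-almost everywhere are identified, and $\hookrightarrow$ denotes a continuous embedding. $(X,d)$ is geometrically doubling if there is $M$ such that, for all $x\in X$ and $r>0$, the ball $B(x,r)$ can be covered by at most $M$ balls of radius $r/2$. Theorem. Assume that there are $Q\in\mathcal P_b^{\log}(X)$, $\delta\in(0,\infty)$ and $b\in(0,1]$ such that $\mu(B(x,r))\ge b\,r^{Q(x)}$ for all $x\in X$ and $r\in(0,\delta]$. (i) If $(X,d)$ is geometrically doubling and $\sup_{x\in X}\mu(B(x,\delta))<\infty$, then for all $p,s\in\mathcal P_b^{\log}(X)$ with $sp\ll Q$, the function $\gamma:=\frac{Qp}{Q-sp}$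 belongs to $\mathcal P_b(X)$ and $M^{s(\cdot),p(\cdot)}(X,d,\mu)\hookrightarrow L^{\gamma(\cdot)}(X,\mu)$. (ii) If $(X,d)$ is geometrically doubling and $\sup_{x\in X}\mu(B(x,\delta))<\infty$, then for all $p,s\in\mathcal P_b^{\log}(X)$ with $sp=Q$ and every $\beta\in\mathcal P_b(X)$ with $\beta\gg p$, $M^{s(\cdot),p(\cdot)}(X,d,\mu)\hookrightarrow L^{\beta(\cdot)}(X,\mu)$. (iii) For all $p,s\in\mathcal P_b^{\log}(X)$ with $sp\gg Q$, the function $\alpha:=s-\frac Qp$ is bounded and non-negative and $M^{s(\cdot),p(\cdot)}(X,d,\mu)\hookrightarrow C^{0,\alpha(\cdot)}(X,d)$. -/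

import Mathlib

open MeasureTheory Metric
open scoped ENNReal NNReal

noncomputable section

namespace VarHajlasz

/-- `(X, d, μ)` is a metric measure space: every ball of positive radius has positive and finite
measure. -/
def IsMetricMeasure {X : Type*} [MetricSpace X] [MeasurableSpace X] (μ : Measure X) : Prop :=
  ∀ (x : X) (r : ℝ), 0 < r → 0 < μ (ball x r) ∧ μ (ball x r) < ∞

/-- `(X, d)` is geometrically doubling: there is `M` such that every ball of radius `r` is covered
by at most `M` balls of radius `r / 2`. -/
def GeometricallyDoubling (X : Type*) [MetricSpace X] : Prop :=
  ∃ M : ℕ, ∀ (x : X) (r : ℝ), 0 < r →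
    ∃ S : Finset X, S.card ≤ M ∧ ball x r ⊆ ⋃ y ∈ S, ball y (r / 2)

/-- The class of essentially bounded variable exponents: measurable positive functions `p` with
`ess inf p > 0` and `ess sup p < ∞`. -/
def BoundedExponent {X : Type*} [MeasurableSpace X] (μ : Measure X) (p : X → ℝ) : Prop :=
  Measurable p ∧ (∀ x, 0 < p x) ∧ (∃ c > 0, ∀ᵐ x ∂μ, c ≤ p x) ∧ (∃ C, ∀ᵐ x ∂μ, p x ≤ C)

/-- `q ≫ p`, that is, `ess inf (q - p) > 0`. -/
def EssGT {X : Type*} [MeasurableSpace X] (μ : Measure X) (q p : X → ℝ) : Prop :=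
  ∃ c > 0, ∀ᵐ x ∂μ, c ≤ q x - p x

/-- Local log-Hölder continuity on the whole space (only pairs of distinct points matter). -/
def LogHolder {X : Type*} [MetricSpace X] (f : X → ℝ) : Prop :=
  ∃ C > 0, ∀ x y : X, x ≠ y → |f x - f y| ≤ C / Real.log (Real.exp 1 + 1 / dist x y)

/-- The class of bounded exponents `p` such that `1 / p` is locally log-Hölder continuous. -/
def LogExponent {X : Type*} [MetricSpace X] [MeasurableSpace X] (μ : Measure X)
    (p : X → ℝ) : Prop :=
  BoundedExponent μ p ∧ LogHolder (fun x => 1 / p x)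

/-- The semi-modular `∫ f(x)^{p(x)} dμ(x)` of a function with values in `[0, ∞]`. -/
def modular {X : Type*} [MeasurableSpace X] (μ : Measure X) (p : X → ℝ) (f : X → ℝ≥0∞) : ℝ≥0∞ :=
  ∫⁻ x, f x ^ p x ∂μ

/-- The Luxemburg quasi-norm `inf {l ∈ (0, ∞) : ρ(f / l) ≤ 1}`, with `inf ∅ = ∞`. -/
def luxNorm {X : Type*} [MeasurableSpace X] (μ : Measure X) (p : X → ℝ) (f : X → ℝ≥0∞) : ℝ≥0∞ :=
  ⨅ (l : ℝ≥0) (_ : 0 < l) (_ : modular μ p (fun x => f x / (l : ℝ≥0∞)) ≤ 1), (l : ℝ≥0∞)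

/-- Membership in the variable exponent Lebesgue space. -/
def MemVarL {X : Type*} [MeasurableSpace X] (μ : Measure X) (p : X → ℝ) (u : X → ℝ) : Prop :=
  AEMeasurable u μ ∧ modular μ p (fun x => ‖u x‖ₑ) < ∞

/-- The quasi-norm of the variable exponent Lebesgue space. -/
def varLNorm {X : Type*} [MeasurableSpace X] (μ : Measure X) (p : X → ℝ) (u : X → ℝ) : ℝ≥0∞ :=
  luxNorm μ p (fun x => ‖u x‖ₑ)

/-- `g : X → [0, ∞]` is a scalar `s(·)`-gradient of `u`: the pointwise inequality holds off a
null set. -/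
def IsScalarGradient {X : Type*} [MetricSpace X] [MeasurableSpace X] (μ : Measure X)
    (s : X → ℝ) (u : X → ℝ) (g : X → ℝ≥0∞) : Prop :=
  ∃ N : Set X, μ N = 0 ∧ ∀ x ∉ N, ∀ y ∉ N,
    ENNReal.ofReal |u x - u y| ≤
      ENNReal.ofReal (dist x y ^ s x) * g x + ENNReal.ofReal (dist x y ^ s y) * g y

/-- The quasi-seminorm of the homogeneous Hajłasz–Sobolev space: the infimum of the `L^{p(·)}`
quasi-norms of the measurable scalar `s(·)`-gradients. -/
def hajlaszSeminorm {X : Type*} [MetricSpace X] [MeasurableSpace X] (μ : Measure X)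
    (s p : X → ℝ) (u : X → ℝ) : ℝ≥0∞ :=
  ⨅ (g : X → ℝ≥0∞) (_ : AEMeasurable g μ) (_ : IsScalarGradient μ s u g), luxNorm μ p g

/-- Membership in the inhomogeneous Hajłasz–Sobolev space `M^{s(·),p(·)}`. -/
def MemHajlasz {X : Type*} [MetricSpace X] [MeasurableSpace X] (μ : Measure X)
    (s p : X → ℝ) (u : X → ℝ) : Prop :=
  MemVarL μ p u ∧ hajlaszSeminorm μ s p u < ∞

/-- The quasi-norm of the inhomogeneous Hajłasz–Sobolev space `M^{s(·),p(·)}`. -/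
def hajlaszNorm {X : Type*} [MetricSpace X] [MeasurableSpace X] (μ : Measure X)
    (s p : X → ℝ) (u : X → ℝ) : ℝ≥0∞ :=
  varLNorm μ p u + hajlaszSeminorm μ s p u

/-- The supremum norm, with values in `[0, ∞]`. -/
def supNorm {X : Type*} (v : X → ℝ) : ℝ≥0∞ := ⨆ x, ‖v x‖ₑ

/-- The variable exponent Hölder seminorm
`sup {|v(x) - v(y)| / d(x,y)^{α(x)} : x ≠ y}`, with values in `[0, ∞]`. -/
def holderSeminorm {X : Type*} [MetricSpace X] (α : X → ℝ) (v : X → ℝ) : ℝ≥0∞ :=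
  ⨆ (x : X) (y : X) (_ : x ≠ y), ENNReal.ofReal (|v x - v y| / dist x y ^ α x)

/-- Membership in the inhomogeneous variable exponent Hölder space `C^{0,α(·)}`. -/
def MemHolder {X : Type*} [MetricSpace X] (α : X → ℝ) (v : X → ℝ) : Prop :=
  Continuous v ∧ supNorm v < ∞ ∧ holderSeminorm α v < ∞

/-- The norm of the inhomogeneous variable exponent Hölder space `C^{0,α(·)}`. -/
def holderNorm {X : Type*} [MetricSpace X] (α : X → ℝ) (v : X → ℝ) : ℝ≥0∞ :=
  supNorm v + holderSeminorm α v

/-- The continuous embedding `M^{s(·),p(·)} ↪ L^{q(·)}`. -/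
def EmbedsInVarL {X : Type*} [MetricSpace X] [MeasurableSpace X] (μ : Measure X)
    (s p q : X → ℝ) : Prop :=
  ∃ C : ℝ≥0, ∀ u : X → ℝ, MemHajlasz μ s p u →
    MemVarL μ q u ∧ varLNorm μ q u ≤ C * hajlaszNorm μ s p u

/-- The continuous embedding `M^{s(·),p(·)} ↪ C^{0,α(·)}`: functions being identified when they
agree almost everywhere, every `u` has a representative in the Hölder space, with control of the
norms. -/
def EmbedsInHolder {X : Type*} [MetricSpace X] [MeasurableSpace X] (μ : Measure X)
    (s p α : X → ℝ) : Prop :=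
  ∃ C : ℝ≥0, ∀ u : X → ℝ, MemHajlasz μ s p u →
    ∃ v : X → ℝ, u =ᵐ[μ] v ∧ MemHolder α v ∧ holderNorm α v ≤ C * hajlaszNorm μ s p u

end VarHajlasz

end

/-! Divide `u` and a gradient `g` by a common `l` so that `H = (|u|/l)^p + (g/l)^p` has integral at
most 2. By Chebyshev, `{H ≥ 2^k}` has measure at most `2/2^k`, whereas the lower mass bound gives a
ball about `x` of radius comparable to `2^(-k/Q(x))` measure at least `3/2^k`. Hence every such ball
meets the set `H ≤ 2^k` (`exists_hasDenseSublevels`).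

From any good `x` one can therefore descend through the levels `2^(k+m), …, 2^k` by steps whose
lengths decay geometrically in the level. A step at level `t` costs about `t^(-s/Q) · t^(1/p) =
t^critExp`. Log-Hölder continuity allows all exponents to be frozen at `x`, because the chain stays
within a multiple of `t^(-θ)` of `x` and a factor `t^(f x - f y)` is then bounded
(`LogHolder.rpow_le_rpow`). This yields `exists_chain`: the increment is a geometric sum with ratio
`2^critExp`.

If `critExp ≤ 1/τ`, the sum is at most a multiple of its top term with `critExp` replaced by `1/τ`,
so `|u|^τ ≤ C H` after scaling, and integration gives the embedding into `L^τ`. This covers `τ = γ`,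
where equality holds, and `τ = β`, where `critExp = 0`. If `critExp ≤ -c < 0`, the bottom term
dominates; descending from `x` and from `y` to the level comparable to `d(x,y)^(-Q(x))` and
comparing the end points gives the Hölder bound with exponent `-Q · critExp = s - Q/p`. -/

namespace VarHajlasz

/-! ### Log-Hölder exponents and the critical exponent. -/

section Exponents

variable {X : Type*} [MetricSpace X]

/-- The exponent `f` is bounded, bounded away from zero, and `1 / f` is log-Hölder continuous. -/
def UniformLogExponent (f : X → ℝ) : Prop :=
  LogHolder (fun x => 1 / f x) ∧ ∃ c C : ℝ, 0 < c ∧ ∀ x, c ≤ f x ∧ f x ≤ C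

lemma one_le_log_exp_add {d : ℝ} (hd : 0 < d) : 1 ≤ Real.log (Real.exp 1 + 1 / d) := by
  rw [Real.le_log_iff_exp_le (by positivity)]
  have : 0 < 1 / d := by positivity
  linarith

lemma LogHolder.continuous {f : X → ℝ} (hf : LogHolder f) : Continuous f := by
  obtain ⟨C, hC, h⟩ := hf
  rw [Metric.continuous_iff]
  intro x ε hε
  refine ⟨(Real.exp (C / ε))⁻¹, inv_pos.2 (Real.exp_pos _), fun y hy => ?_⟩
  rcases eq_or_ne y x with rfl | hne
  · simpa using hε
  have hd : 0 < dist y x := dist_pos.2 hne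
  have h1 : C / ε < Real.log (Real.exp 1 + 1 / dist y x) := by
    rw [Real.lt_log_iff_exp_lt (by positivity)]
    have : Real.exp (C / ε) < 1 / dist y x := by
      rw [one_div]
      exact (lt_inv_comm₀ (Real.exp_pos _) hd).2 hy
    have := Real.exp_pos 1
    linarith
  have hL := one_le_log_exp_add hd
  rw [Real.dist_eq]
  refine (h y x hne).trans_lt ?_
  rw [div_lt_iff₀ (by linarith)]
  rw [div_lt_iff₀ hε] at h1
  linarith

/-- Raising `t ≥ 1` to the values of a log-Hölder function at two points whose distance is at most
a power of `1 / t` gives comparable results. -/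
lemma LogHolder.rpow_le_rpow {f : X → ℝ} (hf : LogHolder f) {θ : ℝ} (hθ : 0 < θ) (K : ℝ) :
    ∃ C : ℝ, 1 ≤ C ∧ ∀ (x y : X) (t : ℝ), 1 ≤ t → dist x y ≤ K * t ^ (-θ) →
      t ^ f x ≤ C * t ^ f y := by
  obtain ⟨B, hB, h⟩ := hf
  set K' := max K 1 with hK'
  have hK1 : 1 ≤ K' := le_max_right _ _
  have hlogK : 0 ≤ Real.log K' := Real.log_nonneg hK1
  have hexp : 0 ≤ B * (1 + Real.log K') / θ := by positivity
  refine ⟨Real.exp (B * (1 + Real.log K') / θ), Real.one_le_exp hexp, ?_⟩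
  intro x y t ht hd
  have ht0 : 0 < t := by linarith
  rcases eq_or_ne x y with rfl | hne
  · exact le_mul_of_one_le_left (by positivity) (Real.one_le_exp hexp)
  have hd0 : 0 < dist x y := dist_pos.2 hne
  have hL := one_le_log_exp_add hd0
  set L := Real.log (Real.exp 1 + 1 / dist x y) with hLdef
  have hfx := h x y hne
  have hd' : dist x y ≤ K' * t ^ (-θ) :=
    hd.trans (mul_le_mul_of_nonneg_right (le_max_left _ _) (by positivity))
  have h1 : Real.log (dist x y) ≤ Real.log K' - θ * Real.log t := by
    have := Real.log_le_log hd0 hd'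
    rwa [Real.log_mul (by positivity) (by positivity), Real.log_rpow ht0, neg_mul,
      ← sub_eq_add_neg] at this
  have h2 : -Real.log (dist x y) ≤ L := by
    rw [← Real.log_inv, hLdef, one_div]
    exact Real.log_le_log (by positivity) (by linarith [Real.exp_pos 1])
  have hlt : 0 ≤ Real.log t := Real.log_nonneg ht
  -- Since `L ≥ 1`, the term `log K'` is absorbed into a multiple of `L`, which then cancels the `1
  -- / L` of the log-Hölder bound.
  have h3 : θ * Real.log t ≤ (1 + Real.log K') * L := by nlinarith
  have h4 : Real.log t * (f x - f y) ≤ B * (1 + Real.log K') / θ := by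
    have h5 : f x - f y ≤ B / L := (le_abs_self _).trans hfx
    calc Real.log t * (f x - f y) ≤ Real.log t * (B / L) := by gcongr
      _ = (θ * Real.log t) * (B / L) / θ := by field_simp
      _ ≤ ((1 + Real.log K') * L) * (B / L) / θ := by gcongr
      _ = B * (1 + Real.log K') / θ := by
        have : L ≠ 0 := by linarith
        field_simp
  rw [Real.rpow_def_of_pos ht0, Real.rpow_def_of_pos ht0, ← Real.exp_add]
  apply Real.exp_le_exp.2
  linarith

/-- Used to transfer radii `t ^ (-(1 / Q))` from one base point to another. -/
lemma rpow_neg_le_of_rpow_le {t a b C : ℝ} (ht : 0 < t) (h : t ^ b ≤ C * t ^ a) :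
    t ^ (-a) ≤ C * t ^ (-b) := by
  rw [Real.rpow_neg ht.le, Real.rpow_neg ht.le, ← div_eq_mul_inv, inv_eq_one_div,
    div_le_div_iff₀ (by positivity) (by positivity), one_mul]
  exact h

lemma LogHolder.mul {f g : X → ℝ} (hf : LogHolder f) (hg : LogHolder g) {A B : ℝ}
    (hA : ∀ x, |f x| ≤ A) (hB : ∀ x, |g x| ≤ B) : LogHolder (fun x => f x * g x) := by
  obtain ⟨C, hC, hf⟩ := hf
  obtain ⟨C', hC', hg⟩ := hg
  refine ⟨|A| * C' + |B| * C + 1, by positivity, fun x y hne => ?_⟩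
  have hL := one_le_log_exp_add (dist_pos.2 hne)
  set L := Real.log (Real.exp 1 + 1 / dist x y)
  have e : f x * g x - f y * g y = f x * (g x - g y) + g y * (f x - f y) := by ring
  rw [e]
  calc |f x * (g x - g y) + g y * (f x - f y)|
      ≤ |f x| * |g x - g y| + |g y| * |f x - f y| := by
        rw [← abs_mul, ← abs_mul]; exact abs_add_le _ _
    _ ≤ |A| * (C' / L) + |B| * (C / L) := by
        exact add_le_add
          (mul_le_mul ((hA x).trans (le_abs_self _)) (hg x y hne) (abs_nonneg _) (abs_nonneg _))
          (mul_le_mul ((hB y).trans (le_abs_self _)) (hf x y hne) (abs_nonneg _) (abs_nonneg _))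
    _ ≤ (|A| * C' + |B| * C + 1) / L := by
        rw [← sub_nonneg]
        have : (|A| * C' + |B| * C + 1) / L - (|A| * (C' / L) + |B| * (C / L)) = 1 / L := by
          field_simp; ring
        rw [this]; positivity

lemma LogHolder.sub {f g : X → ℝ} (hf : LogHolder f) (hg : LogHolder g) :
    LogHolder (fun x => f x - g x) := by
  obtain ⟨C, hC, hf⟩ := hf
  obtain ⟨C', hC', hg⟩ := hg
  refine ⟨C + C', by positivity, fun x y hne => ?_⟩
  have e : f x - g x - (f y - g y) = (f x - f y) - (g x - g y) := by ring
  rw [e, add_div]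
  exact (abs_sub _ _).trans (add_le_add (hf x y hne) (hg x y hne))

lemma UniformLogExponent.pos {f : X → ℝ} (hf : UniformLogExponent f) (x : X) : 0 < f x := by
  obtain ⟨_, c, C, hc, h⟩ := hf
  exact hc.trans_le (h x).1

/-- The difference `f x - f y` is the bounded factor `f x * f y` times a difference of reciprocals.
-/
lemma UniformLogExponent.logHolder {f : X → ℝ} (hf : UniformLogExponent f) : LogHolder f := by
  have hpos := hf.pos
  obtain ⟨⟨B, hB, h⟩, c, C, hc, hb⟩ := hf
  refine ⟨(|C| + 1) * (|C| + 1) * B, by positivity, fun x y hne => ?_⟩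
  have hx := hpos x
  have hy := hpos y
  have e : f x - f y = f x * f y * (1 / f y - 1 / f x) := by field_simp
  have hCx : f x ≤ |C| + 1 := by linarith [(hb x).2, le_abs_self C]
  have hCy : f y ≤ |C| + 1 := by linarith [(hb y).2, le_abs_self C]
  have hL := one_le_log_exp_add (dist_pos.2 hne)
  have h' := h x y hne
  rw [abs_sub_comm] at h'
  rw [e, abs_mul, abs_of_pos (by positivity : 0 < f x * f y), mul_div_assoc]
  gcongr

/-- The exponent `1 / p - s / Q`, the reciprocal of the Sobolev exponent in the subcritical
case. -/
noncomputable def critExp (Q p s : X → ℝ) (x : X) : ℝ := 1 / p x - s x / Q x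

lemma UniformLogExponent.logHolder_critExp {Q p s : X → ℝ} (hQ : UniformLogExponent Q)
    (hp : UniformLogExponent p) (hs : UniformLogExponent s) : LogHolder (critExp Q p s) := by
  have hsL := hs.logHolder
  have hs0 := hs.pos
  have hQ0 := hQ.pos
  obtain ⟨_, cs, Cs, hcs, hsb⟩ := hs
  obtain ⟨hQL, cQ, CQ, hcQ, hQb⟩ := hQ
  have := hp.1.sub (hsL.mul hQL (A := Cs) (B := 1 / cQ)
    (fun x => by rw [abs_of_pos (hs0 x)]; exact (hsb x).2)
    (fun x => by
      rw [abs_of_pos (one_div_pos.2 (hQ0 x))]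
      exact one_div_le_one_div_of_le hcQ (hQb x).1))
  have e : critExp Q p s = fun x => 1 / p x - s x * (1 / Q x) := by
    funext x
    rw [critExp, mul_one_div]
  rwa [e]

/-- A point at distance comparable to `t ^ (-1 / Q)` contributes at most a multiple of
`t ^ critExp` to the increment of the function. -/
lemma rpow_dist_mul_rpow_le {Q p s : X → ℝ} (hp : UniformLogExponent p)
    (hs : UniformLogExponent s) (K : ℝ) :
    ∃ C : ℝ, 0 ≤ C ∧ ∀ (x : X) (t d h : ℝ), 1 ≤ t → 0 ≤ d → d ≤ K * t ^ (-(1 / Q x)) → 0 ≤ h →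
      h ≤ 2 * t → d ^ s x * h ^ (1 / p x) ≤ C * t ^ critExp Q p s x := by
  have hs0 := hs.pos
  have hp0 := hp.pos
  obtain ⟨_, cs, Cs, hcs, hsb⟩ := hs
  obtain ⟨_, cp, Cp, hcp, hpb⟩ := hp
  set K' := max K 1
  have hK1 : 1 ≤ K' := le_max_right _ _
  refine ⟨K' ^ Cs * 2 ^ (1 / cp), by positivity, fun x t d h ht hd hdK hh hht => ?_⟩
  have ht0 : 0 < t := by linarith
  have h1 : d ^ s x ≤ K' ^ Cs * t ^ (-(1 / Q x) * s x) := by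
    calc d ^ s x ≤ (K' * t ^ (-(1 / Q x))) ^ s x := by
          refine Real.rpow_le_rpow hd (hdK.trans ?_) (hs0 x).le
          exact mul_le_mul_of_nonneg_right (le_max_left _ _) (by positivity)
      _ = K' ^ s x * t ^ (-(1 / Q x) * s x) := by
          rw [Real.mul_rpow (by positivity) (by positivity), ← Real.rpow_mul ht0.le]
      _ ≤ _ := by
          gcongr
          exact (hsb x).2
  have h2 : h ^ (1 / p x) ≤ 2 ^ (1 / cp) * t ^ (1 / p x) := by
    calc h ^ (1 / p x) ≤ (2 * t) ^ (1 / p x) :=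
          Real.rpow_le_rpow hh hht (one_div_pos.2 (hp0 x)).le
      _ = 2 ^ (1 / p x) * t ^ (1 / p x) := Real.mul_rpow (by norm_num) ht0.le
      _ ≤ _ := by
          gcongr
          · norm_num
          · exact (hpb x).1
  calc d ^ s x * h ^ (1 / p x)
      ≤ (K' ^ Cs * t ^ (-(1 / Q x) * s x)) * (2 ^ (1 / cp) * t ^ (1 / p x)) := by gcongr
    _ = K' ^ Cs * 2 ^ (1 / cp) * (t ^ (-(1 / Q x) * s x) * t ^ (1 / p x)) := by ring
    _ = _ := by
      rw [← Real.rpow_add ht0]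
      congr 2
      rw [critExp]; ring

end Exponents

/-! ### Descent through the sublevel sets of `H`. -/

section Chain

variable {X : Type*} [MetricSpace X]

/-- The function `u` has on `D` the gradient `H ^ (1 / p)`, which also bounds it, and the
sublevel sets of `H` of high level come close to every point. -/
structure HasDenseSublevels (D : Set X) (Q p s u H : X → ℝ) (A : ℝ) (k₀ : ℕ) : Prop where
  nonneg : ∀ x, 0 ≤ H x
  grad : ∀ x ∈ D, ∀ y ∈ D,
    |u x - u y| ≤ dist x y ^ s x * H x ^ (1 / p x) + dist x y ^ s y * H y ^ (1 / p y)
  size : ∀ x ∈ D, |u x| ≤ H x ^ (1 / p x)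
  near : ∀ x, ∀ k ≥ k₀, ∃ y ∈ D, dist x y ≤ A * ((2 : ℝ) ^ k) ^ (-(1 / Q x)) ∧ H y ≤ 2 ^ k

/-- Between two points of the sublevel set `H ≤ 2t` at distance at most `K t ^ (-1 / Q)`, the
increment of `u` is at most a multiple of `t ^ critExp`. -/
lemma abs_sub_le_of_dist_le {Q p s : X → ℝ} (hQ : UniformLogExponent Q)
    (hp : UniformLogExponent p) (hs : UniformLogExponent s) (K : ℝ) :
    ∃ C : ℝ, 0 ≤ C ∧ ∀ (D : Set X) (u H : X → ℝ) (A : ℝ) (k₀ : ℕ),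
      HasDenseSublevels D Q p s u H A k₀ →
      ∀ x ∈ D, ∀ y ∈ D, ∀ t : ℝ, 1 ≤ t → H x ≤ 2 * t → H y ≤ 2 * t →
        dist x y ≤ K * t ^ (-(1 / Q x)) → |u x - u y| ≤ C * t ^ critExp Q p s x := by
  have he := hQ.logHolder_critExp hp hs
  have hQ0 := hQ.pos
  obtain ⟨hQL, cQ, CQ, hcQ, hQb⟩ := id hQ
  -- A point is needed to know that the upper bound `CQ` is positive.
  rcases isEmpty_or_nonempty X with hX | ⟨⟨x₀⟩⟩
  · exact ⟨0, le_rfl, fun D u H A k₀ h x => (hX.false x).elim⟩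
  have hCQ : 0 < CQ := (hQ0 x₀).trans_le (hQb x₀).2
  set K' := max K 0
  have hK' : 0 ≤ K' := le_max_right _ _
  obtain ⟨C₁, hC₁, h₁⟩ := hQL.rpow_le_rpow (one_div_pos.2 hCQ) K'
  obtain ⟨C₂, hC₂, h₂⟩ := he.rpow_le_rpow (one_div_pos.2 hCQ) K'
  obtain ⟨C₃, hC₃, h₃⟩ := rpow_dist_mul_rpow_le (Q := Q) hp hs (K' * C₁)
  refine ⟨C₃ + C₃ * C₂, by positivity, fun D u H A k₀ h x hx y hy t ht hHx hHy hd => ?_⟩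
  have ht0 : 0 < t := by linarith
  have hd' : dist x y ≤ K' * t ^ (-(1 / Q x)) :=
    hd.trans (mul_le_mul_of_nonneg_right (le_max_left _ _) (by positivity))
  have hdθ : dist x y ≤ K' * t ^ (-(1 / CQ)) := hd'.trans <| by
    gcongr
    · exact hQ0 x
    · exact (hQb x).2
  have hdθ' : dist y x ≤ K' * t ^ (-(1 / CQ)) := by rwa [dist_comm]
  have hdx : dist x y ≤ K' * C₁ * t ^ (-(1 / Q x)) := hd'.trans <| by
    rw [mul_assoc]; gcongr; exact le_mul_of_one_le_left (by positivity) hC₁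
  -- The gradient inequality has a term with exponents at `y`, so the distance must also be measured
  -- by the radius at `y`.
  have hdy : dist x y ≤ K' * C₁ * t ^ (-(1 / Q y)) := hd'.trans <| by
    rw [mul_assoc]
    gcongr
    exact rpow_neg_le_of_rpow_le ht0 (h₁ y x t ht hdθ')
  calc |u x - u y| ≤ _ := h.grad x hx y hy
    _ ≤ C₃ * t ^ critExp Q p s x + C₃ * t ^ critExp Q p s y := by
        exact add_le_add (h₃ x t _ _ ht dist_nonneg hdx (h.nonneg x) hHx)
          (h₃ y t _ _ ht dist_nonneg hdy (h.nonneg y) hHy)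
    _ ≤ C₃ * t ^ critExp Q p s x + C₃ * (C₂ * t ^ critExp Q p s x) := by
        gcongr
        exact h₂ y x t ht hdθ'
    _ = _ := by ring

/-- Descending through the sublevel sets of `H` from a point `x` to level `2 ^ k`. -/
theorem exists_chain {Q p s : X → ℝ} (hQ : UniformLogExponent Q)
    (hp : UniformLogExponent p) (hs : UniformLogExponent s) (A : ℝ) :
    ∃ C K : ℝ, 0 ≤ C ∧ 0 ≤ K ∧ ∀ (D : Set X) (u H : X → ℝ) (k₀ : ℕ),
      HasDenseSublevels D Q p s u H A k₀ →
      ∀ x ∈ D, ∀ (m k : ℕ), k₀ ≤ k → H x ≤ 2 ^ (k + m) →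
        ∃ y ∈ D, H y ≤ 2 ^ k ∧ dist x y ≤ K * ((2 : ℝ) ^ k) ^ (-(1 / Q x)) ∧
          |u x - u y| ≤ C * ∑ j ∈ Finset.range m, ((2 : ℝ) ^ (k + j)) ^ critExp Q p s x := by
  have he := hQ.logHolder_critExp hp hs
  have hQ0 := hQ.pos
  obtain ⟨hQL, cQ, CQ, hcQ, hQb⟩ := id hQ
  rcases isEmpty_or_nonempty X with hX | ⟨⟨x₀⟩⟩
  · exact ⟨0, 0, le_rfl, le_rfl, fun D u H k₀ h x => (hX.false x).elim⟩
  have hCQ : 0 < CQ := (hQ0 x₀).trans_le (hQb x₀).2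
  set θ := 1 / CQ with hθdef
  have hθ : 0 < θ := one_div_pos.2 hCQ
  have hθQ : ∀ x, θ ≤ 1 / Q x := fun x => one_div_le_one_div_of_le (hQ0 x) (hQb x).2
  set A' := max A 0
  have hA' : 0 ≤ A' := le_max_right _ _
  -- Radii shrink at least by the factor `1 - η` per level, so `A' / η` is the sum of the geometric
  -- series of step lengths.
  set η : ℝ := 1 - 2 ^ (-θ)
  have hη : 0 < η := by
    have : (2 : ℝ) ^ (-θ) < 1 := Real.rpow_lt_one_of_one_lt_of_neg (by norm_num) (by linarith)
    simp only [η]; linarith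
  have hstep : ∀ (k : ℕ) (σ : ℝ), θ ≤ σ →
      ((2 : ℝ) ^ (k + 1)) ^ (-σ) ≤ (1 - η) * ((2 : ℝ) ^ k) ^ (-σ) := by
    intro k σ hσ
    rw [pow_succ, Real.mul_rpow (by positivity) (by norm_num), mul_comm]
    gcongr
    simp only [η, sub_sub_cancel]
    exact Real.rpow_le_rpow_of_exponent_le (by norm_num) (by linarith)
  obtain ⟨C₁, hC₁, h₁⟩ := hQL.rpow_le_rpow hθ (A' / η)
  obtain ⟨C₂, hC₂, h₂⟩ := he.rpow_le_rpow hθ (A' / η)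
  obtain ⟨C₃, hC₃, h₃⟩ := abs_sub_le_of_dist_le hQ hp hs A'
  -- Two distance bounds are carried along. The crude one, with fixed exponent `θ`, has a constant
  -- free of `C₁` and is what licenses freezing exponents at `x`; the sharp one, with `1 / Q x`,
  -- follows from it. Using the sharp one alone would be circular, as `C₁` depends on the distance
  -- constant.
  have main : ∀ (D : Set X) (u H : X → ℝ) (k₀ : ℕ),
      HasDenseSublevels D Q p s u H A k₀ →
      ∀ x ∈ D, ∀ (m k : ℕ), k₀ ≤ k → H x ≤ 2 ^ (k + m) →
        ∃ y ∈ D, H y ≤ 2 ^ k ∧ dist x y ≤ A' / η * ((2 : ℝ) ^ k) ^ (-θ) ∧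
          dist x y ≤ A' * C₁ / η * ((2 : ℝ) ^ k) ^ (-(1 / Q x)) ∧
          |u x - u y| ≤
            C₃ * C₂ * ∑ j ∈ Finset.range m, ((2 : ℝ) ^ (k + j)) ^ critExp Q p s x := by
    intro D u H k₀ h x hx m
    induction m with
    | zero =>
      intro k hk hH
      refine ⟨x, hx, by simpa using hH, ?_, ?_, ?_⟩
      · rw [dist_self]; positivity
      · rw [dist_self]; positivity
      · simp
    | succ m ih =>
      intro k hk hH
      -- Descend to level `k + 1` first; one more step, from `y` to `z`, reaches level `k`.
      obtain ⟨y, hy, hHy, hd1, hd2, huy⟩ := ih (k + 1) (by omega) (by rwa [add_assoc, add_comm 1])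
      obtain ⟨z, hz, hyz, hHz⟩ := h.near y k hk
      have ht : (1 : ℝ) ≤ 2 ^ k := one_le_pow₀ (by norm_num)
      have ht0 : (0 : ℝ) < 2 ^ k := by positivity
      have hyz' : dist y z ≤ A' * ((2 : ℝ) ^ k) ^ (-(1 / Q y)) :=
        hyz.trans (mul_le_mul_of_nonneg_right (le_max_left _ _) (by positivity))
      have hxy : dist x y ≤ A' / η * ((2 : ℝ) ^ k) ^ (-θ) := hd1.trans <| by
        gcongr ?_ * ?_
        refine (hstep k θ le_rfl).trans ?_
        exact mul_le_of_le_one_left (by positivity) (by linarith)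
      have hyx : dist y x ≤ A' / η * ((2 : ℝ) ^ k) ^ (-θ) := by rwa [dist_comm]
      have hyz2 : dist y z ≤ A' * C₁ * ((2 : ℝ) ^ k) ^ (-(1 / Q x)) := hyz'.trans <| by
        rw [mul_assoc]
        gcongr
        exact rpow_neg_le_of_rpow_le ht0 (h₁ x y _ ht hxy)
      have hyz1 : dist y z ≤ A' * ((2 : ℝ) ^ k) ^ (-θ) := hyz'.trans <| by
        gcongr
        exact hθQ y
      refine ⟨z, hz, hHz, ?_, ?_, ?_⟩
      · calc dist x z ≤ dist x y + dist y z := dist_triangle _ _ _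
          _ ≤ A' / η * ((1 - η) * ((2 : ℝ) ^ k) ^ (-θ)) + A' * ((2 : ℝ) ^ k) ^ (-θ) := by
              gcongr
              exact hd1.trans (mul_le_mul_of_nonneg_left (hstep k θ le_rfl) (by positivity))
          _ = _ := by field_simp; ring
      · calc dist x z ≤ dist x y + dist y z := dist_triangle _ _ _
          _ ≤ A' * C₁ / η * ((1 - η) * ((2 : ℝ) ^ k) ^ (-(1 / Q x)))
                + A' * C₁ * ((2 : ℝ) ^ k) ^ (-(1 / Q x)) := by
              gcongr
              exact hd2.trans (mul_le_mul_of_nonneg_left (hstep k _ (hθQ x)) (by positivity))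
          _ = _ := by field_simp; ring
      · have h5 : |u y - u z| ≤ C₃ * ((2 : ℝ) ^ k) ^ critExp Q p s y := by
          refine h₃ D u H A k₀ h y hy z hz _ ht ?_ ?_ hyz'
          · rwa [← pow_succ']
          · linarith
        calc |u x - u z| ≤ |u x - u y| + |u y - u z| := abs_sub_le _ _ _
          _ ≤ C₃ * C₂ * ∑ j ∈ Finset.range m, ((2 : ℝ) ^ (k + 1 + j)) ^ critExp Q p s x
                + C₃ * (C₂ * ((2 : ℝ) ^ k) ^ critExp Q p s x) := by
              gcongr
              exact h5.trans (mul_le_mul_of_nonneg_left (h₂ y x _ ht hyx) hC₃)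
          _ = _ := by
              rw [Finset.sum_range_succ', add_zero, mul_add, mul_assoc C₃ C₂ (_ ^ _)]
              congr 2
              refine Finset.sum_congr rfl fun j _ => ?_
              rw [add_assoc, add_comm 1 j]
  refine ⟨C₃ * C₂, A' * C₁ / η, by positivity, by positivity, ?_⟩
  intro D u H k₀ h x hx m k hk hH
  obtain ⟨y, hy, hHy, -, hd, hu⟩ := main D u H k₀ h x hx m k hk hH
  exact ⟨y, hy, hHy, hd, hu⟩

end Chain

/-! ### Pointwise Sobolev and Morrey estimates. -/

section Pointwise

variable {X : Type*} [MetricSpace X]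

lemma HasDenseSublevels.abs_le {D : Set X} {Q p s u H : X → ℝ} {A : ℝ} {k₀ : ℕ}
    (h : HasDenseSublevels D Q p s u H A k₀) {c : ℝ} (hc : 0 < c) (hp : ∀ x, c ≤ p x) {y : X}
    (hy : y ∈ D) {k : ℕ} (hk : H y ≤ 2 ^ k) : |u y| ≤ ((2 : ℝ) ^ k) ^ (1 / c) := by
  have hpy : 0 < p y := hc.trans_le (hp y)
  calc |u y| ≤ H y ^ (1 / p y) := h.size y hy
    _ ≤ ((2 : ℝ) ^ k) ^ (1 / p y) := Real.rpow_le_rpow (h.nonneg y) hk (by positivity)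
    _ ≤ _ := Real.rpow_le_rpow_of_exponent_le (one_le_pow₀ (by norm_num))
        (one_div_le_one_div_of_le hc (hp y))

lemma two_pow_add_rpow (k j : ℕ) (e : ℝ) :
    ((2 : ℝ) ^ (k + j)) ^ e = ((2 : ℝ) ^ k) ^ e * ((2 : ℝ) ^ e) ^ j := by
  rw [pow_add, Real.mul_rpow (by positivity) (by positivity), Real.rpow_pow_comm (by norm_num)]

/-- The ratio `2 ^ e` stays above `2 ^ c > 1`, so the top of the geometric sum dominates, uniformly
in `e`. -/
lemma sum_rpow_le_of_pos {e c : ℝ} (hc : 0 < c) (he : c ≤ e) (k m : ℕ) :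
    ∑ j ∈ Finset.range m, ((2 : ℝ) ^ (k + j)) ^ e ≤ ((2 : ℝ) ^ (k + m)) ^ e / (2 ^ c - 1) := by
  have h1 : (1 : ℝ) < 2 ^ c := Real.one_lt_rpow (by norm_num) hc
  have h2 : (2 : ℝ) ^ c ≤ 2 ^ e := Real.rpow_le_rpow_of_exponent_le (by norm_num) he
  simp_rw [two_pow_add_rpow]
  rw [← Finset.mul_sum, mul_div_assoc]
  gcongr
  rw [le_div_iff₀ (by linarith)]
  calc (∑ j ∈ Finset.range m, ((2 : ℝ) ^ e) ^ j) * (2 ^ c - 1)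
      ≤ (∑ j ∈ Finset.range m, ((2 : ℝ) ^ e) ^ j) * (2 ^ e - 1) := by
        gcongr
    _ = ((2 : ℝ) ^ e) ^ m - 1 := geom_sum_mul _ _
    _ ≤ _ := by linarith

/-- Here the ratio is at most `2 ^ (-c) < 1`, and the bottom term dominates independently of the
length `m`. -/
lemma sum_rpow_le_of_neg {e c : ℝ} (hc : 0 < c) (he : e ≤ -c) (k m : ℕ) :
    ∑ j ∈ Finset.range m, ((2 : ℝ) ^ (k + j)) ^ e ≤ 1 / (1 - 2 ^ (-c)) * ((2 : ℝ) ^ k) ^ e := by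
  have h1 : (2 : ℝ) ^ (-c) < 1 := Real.rpow_lt_one_of_one_lt_of_neg (by norm_num) (by linarith)
  have h2 : (2 : ℝ) ^ e ≤ 2 ^ (-c) := Real.rpow_le_rpow_of_exponent_le (by norm_num) he
  simp_rw [two_pow_add_rpow]
  rw [← Finset.mul_sum, mul_comm]
  gcongr
  rw [le_div_iff₀ (by linarith)]
  calc (∑ j ∈ Finset.range m, ((2 : ℝ) ^ e) ^ j) * (1 - 2 ^ (-c))
      ≤ (∑ j ∈ Finset.range m, ((2 : ℝ) ^ e) ^ j) * (1 - 2 ^ e) := by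
        gcongr
    _ = 1 - ((2 : ℝ) ^ e) ^ m := geom_sum_mul_neg _ _
    _ ≤ _ := by
      have : 0 ≤ ((2 : ℝ) ^ e) ^ m := by positivity
      linarith

/-- The pointwise form of the Sobolev embedding: `|u| ^ τ ≤ C H`, for every exponent `τ ≥ p` with
`1 / p - s / Q ≤ 1 / τ`. -/
theorem abs_rpow_le_of_critExp_le {Q p s : X → ℝ} (hQ : UniformLogExponent Q)
    (hp : UniformLogExponent p) (hs : UniformLogExponent s) (A : ℝ) (k₀ : ℕ) (T : ℝ) :
    ∃ C : ℝ, 1 ≤ C ∧ ∀ (D : Set X) (u H : X → ℝ), HasDenseSublevels D Q p s u H A k₀ →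
      ∀ x ∈ D, ∀ τ : ℝ, p x ≤ τ → τ ≤ T → critExp Q p s x ≤ 1 / τ → |u x| ^ τ ≤ C * H x := by
  have hp0 := hp.pos
  obtain ⟨C, K, hC, hK, hchain⟩ := exists_chain hQ hp hs A
  obtain ⟨-, cp, Cp, hcp, hpb⟩ := hp
  set B : ℝ := ((2 : ℝ) ^ k₀) ^ (1 / cp)
  have hB : 0 ≤ B := by positivity
  set M : ℝ := max (B + C * (1 / (2 ^ (1 / T) - 1))) 1 with hM
  have hM1 : 1 ≤ M := le_max_right _ _
  refine ⟨max (M ^ T * 2 ^ (k₀ + 1)) 1, le_max_right _ _, fun D u H h x hx τ hpτ hτT heτ => ?_⟩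
  have hτ : 0 < τ := (hp0 x).trans_le hpτ
  have hT : 0 < T := hτ.trans_le hτT
  have hHx := h.nonneg x
  -- For `H x ≤ 1` no chain is needed: the size bound and `τ ≥ p x` suffice. For `H x ≥ 1` the chain
  -- runs down to the fixed level `k₀`.
  rcases le_total (H x) 1 with hH1 | hH1
  · calc |u x| ^ τ ≤ (H x ^ (1 / p x)) ^ τ :=
          Real.rpow_le_rpow (abs_nonneg _) (h.size x hx) hτ.le
      _ = H x ^ (1 / p x * τ) := (Real.rpow_mul hHx _ _).symm
      _ ≤ H x ^ (1 : ℝ) := by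
          apply Real.rpow_le_rpow_of_exponent_ge' hHx hH1 zero_le_one
          rw [one_div_mul_eq_div, le_div_iff₀ (hp0 x), one_mul]
          exact hpτ
      _ = H x := Real.rpow_one _
      _ ≤ _ := le_mul_of_one_le_left hHx (le_max_right _ _)
  · obtain ⟨n, hn, hn'⟩ := exists_nat_pow_near hH1 (one_lt_two (α := ℝ))
    have hHk : H x ≤ 2 ^ (k₀ + (n + 1)) :=
      hn'.le.trans (pow_le_pow_right₀ (by norm_num) (by omega))
    obtain ⟨y, hy, hHy, -, hu⟩ := hchain D u H k₀ h x hx (n + 1) k₀ le_rfl hHk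
    have huy := h.abs_le hcp (fun x => (hpb x).1) hy hHy
    set S : ℝ := (2 : ℝ) ^ (k₀ + (n + 1)) with hS
    have hS1 : 1 ≤ S := one_le_pow₀ (by norm_num)
    have hS1' : 1 ≤ S ^ (1 / τ) := Real.one_le_rpow hS1 (by positivity)
    -- Raising the exponent to `1 / τ ≥ 1 / T` before summing keeps the ratio uniformly above 1,
    -- even where `critExp` is zero or negative.
    have hsum : ∑ j ∈ Finset.range (n + 1), ((2 : ℝ) ^ (k₀ + j)) ^ critExp Q p s x ≤
        S ^ (1 / τ) / (2 ^ (1 / T) - 1) := by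
      refine le_trans (Finset.sum_le_sum fun j _ => ?_)
        (sum_rpow_le_of_pos (one_div_pos.2 hT) (one_div_le_one_div_of_le hτ hτT) k₀ (n + 1))
      exact Real.rpow_le_rpow_of_exponent_le (one_le_pow₀ (by norm_num)) heτ
    have hux : |u x| ≤ M * S ^ (1 / τ) := by
      calc |u x| ≤ |u y| + |u x - u y| := by
            have := abs_add_le (u y) (u x - u y)
            simpa using this
        _ ≤ B * S ^ (1 / τ) + C * (S ^ (1 / τ) / (2 ^ (1 / T) - 1)) :=
            add_le_add (huy.trans (le_mul_of_one_le_right hB hS1'))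
              (hu.trans (mul_le_mul_of_nonneg_left hsum hC))
        _ = (B + C * (1 / (2 ^ (1 / T) - 1))) * S ^ (1 / τ) := by ring
        _ ≤ M * S ^ (1 / τ) := by gcongr; exact le_max_left _ _
    calc |u x| ^ τ ≤ (M * S ^ (1 / τ)) ^ τ := Real.rpow_le_rpow (abs_nonneg _) hux hτ.le
      _ = M ^ τ * S := by
          rw [Real.mul_rpow (by positivity) (by positivity), ← Real.rpow_mul (by positivity),
            one_div_mul_cancel hτ.ne', Real.rpow_one]
      _ ≤ M ^ T * (2 ^ (k₀ + 1) * H x) := by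
          refine mul_le_mul (Real.rpow_le_rpow_of_exponent_le hM1 hτT) ?_ (by positivity)
            (by positivity)
          rw [hS, show k₀ + (n + 1) = k₀ + 1 + n by ring, pow_add]
          gcongr
      _ = M ^ T * 2 ^ (k₀ + 1) * H x := by ring
      _ ≤ _ := by gcongr; exact le_max_left _ _

/-- Makes the loss from changing the base of a `critExp` power by a bounded factor uniform in the
point. -/
lemma UniformLogExponent.exists_neg_le_critExp {Q p s : X → ℝ} (hQ : UniformLogExponent Q)
    (hp : UniformLogExponent p) (hs : UniformLogExponent s) :
    ∃ E : ℝ, 0 ≤ E ∧ ∀ x, -E ≤ critExp Q p s x := by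
  have hs0 := hs.pos
  have hp0 := hp.pos
  obtain ⟨-, cs, Cs, hcs, hsb⟩ := hs
  obtain ⟨-, cQ, CQ, hcQ, hQb⟩ := hQ
  rcases isEmpty_or_nonempty X with hX | ⟨⟨x₀⟩⟩
  · exact ⟨0, le_rfl, fun x => (hX.false x).elim⟩
  have hCs : 0 ≤ Cs := (hs0 x₀).le.trans (hsb x₀).2
  refine ⟨Cs / cQ, by positivity, fun x => ?_⟩
  have h1 : s x / Q x ≤ Cs / cQ := div_le_div₀ hCs (hsb x).2 hcQ (hQb x).1
  have h2 : 0 < 1 / p x := one_div_pos.2 (hp0 x)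
  rw [critExp]
  linarith

/-- The pointwise form of the Morrey embedding. -/
theorem abs_sub_le_of_critExp_le_neg {Q p s : X → ℝ} (hQ : UniformLogExponent Q)
    (hp : UniformLogExponent p) (hs : UniformLogExponent s) (A : ℝ) (k₀ : ℕ) {c : ℝ}
    (hc : 0 < c) (hcrit : ∀ x, critExp Q p s x ≤ -c) :
    ∃ C : ℝ, 0 < C ∧ ∀ (D : Set X) (u H : X → ℝ), HasDenseSublevels D Q p s u H A k₀ →
      ∀ x ∈ D, |u x| ≤ C ∧
        ∀ y ∈ D, |u x - u y| ≤ C * dist x y ^ (-Q x * critExp Q p s x) := by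
  have he := hQ.logHolder_critExp hp hs
  have hQ0 := hQ.pos
  rcases isEmpty_or_nonempty X with hX | ⟨⟨x₀⟩⟩
  · exact ⟨1, one_pos, fun D u H h x => (hX.false x).elim⟩
  obtain ⟨E, hE, hEb⟩ := hQ.exists_neg_le_critExp hp hs
  obtain ⟨C, K, hC, hK, hchain⟩ := exists_chain hQ hp hs A
  obtain ⟨hQL, cQ, CQ, hcQ, hQb⟩ := id hQ
  obtain ⟨-, cp, Cp, hcp, hpb⟩ := id hp
  have hCQ : 0 < CQ := (hQ0 x₀).trans_le (hQb x₀).2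
  set θ := 1 / CQ with hθdef
  have hθ : 0 < θ := one_div_pos.2 hCQ
  have hθQ : ∀ x, θ ≤ 1 / Q x := fun x => one_div_le_one_div_of_le (hQ0 x) (hQb x).2
  set K' := max K 1
  have hK1 : 1 ≤ K' := le_max_right _ _
  have hKK : K ≤ K' := le_max_left _ _
  obtain ⟨C₁, hC₁, h₁⟩ := hQL.rpow_le_rpow hθ K'
  obtain ⟨C₂, hC₂, h₂⟩ := he.rpow_le_rpow hθ K'
  -- The summands are the legs from `x'` to `x`, `x` to `y` and `y` to `y'`, in units of the radius
  -- at `x`; the last factor `C₁` moves the radius to `x'`.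
  obtain ⟨C₃, hC₃, h₃⟩ := abs_sub_le_of_dist_le hQ hp hs ((K + 1 + K * C₁) * C₁)
  set S : ℝ := 1 / (1 - 2 ^ (-c))
  have hS : 0 ≤ S := by
    have : (2 : ℝ) ^ (-c) < 1 := Real.rpow_lt_one_of_one_lt_of_neg (by norm_num) (by linarith)
    exact one_div_nonneg.2 (by linarith)
  set B : ℝ := ((2 : ℝ) ^ k₀) ^ (1 / cp)
  have hB : 0 ≤ B := by positivity
  set M₀ : ℝ := B + C * S
  have hM₀ : 0 ≤ M₀ := by positivity
  set M₁ : ℝ := 2 * M₀ * ((2 : ℝ) ^ k₀) ^ E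
  have hM₁ : 0 ≤ M₁ := by positivity
  set M₂ : ℝ := (C * S + C₃ * C₂ + C * S * C₂) * 2 ^ E
  have hM₂ : 0 ≤ M₂ := by positivity
  have hsup : ∀ (D : Set X) (u H : X → ℝ), HasDenseSublevels D Q p s u H A k₀ →
      ∀ x ∈ D, |u x| ≤ M₀ := by
    intro D u H h x hx
    obtain ⟨n, hn⟩ := pow_unbounded_of_one_lt (H x) (one_lt_two (α := ℝ))
    obtain ⟨y, hy, hHy, -, hu⟩ := hchain D u H k₀ h x hx n k₀ le_rfl
      (hn.le.trans (pow_le_pow_right₀ (by norm_num) (by omega)))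
    have huy := h.abs_le hcp (fun x => (hpb x).1) hy hHy
    have hle : ((2 : ℝ) ^ k₀) ^ critExp Q p s x ≤ 1 :=
      Real.rpow_le_one_of_one_le_of_nonpos (one_le_pow₀ (by norm_num)) (by linarith [hcrit x])
    calc |u x| ≤ |u y| + |u x - u y| := by
          have := abs_add_le (u y) (u x - u y)
          simpa using this
      _ ≤ B + C * (S * ((2 : ℝ) ^ k₀) ^ critExp Q p s x) :=
          add_le_add huy (hu.trans (mul_le_mul_of_nonneg_left
            (sum_rpow_le_of_neg hc (hcrit x) k₀ n) hC))
      _ ≤ B + C * (S * 1) := by gcongr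
      _ = M₀ := by simp only [M₀, mul_one]
  refine ⟨M₀ + M₁ + M₂ + 1, by positivity, fun D u H h x hx =>
    ⟨(hsup D u H h x hx).trans (by linarith), fun y hy => ?_⟩⟩
  rcases eq_or_ne x y with rfl | hne
  · rw [sub_self, abs_zero]; positivity
  have hd : 0 < dist x y := dist_pos.2 hne
  rw [Real.rpow_mul hd.le]
  -- `T` is the level whose natural radius at `x` is exactly `dist x y`.
  set T := dist x y ^ (-Q x) with hT
  have hT0 : 0 < T := by positivity
  have hTe : 0 < T ^ critExp Q p s x := by positivity
  have hneg : critExp Q p s x ≤ 0 := by linarith [hcrit x]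
  -- For small `T` the points are far apart and the supremum bound is enough, since `T ^ critExp` is
  -- then bounded below.
  rcases lt_or_ge T (2 ^ k₀) with hTk | hTk
  · have h4 : 1 ≤ ((2 : ℝ) ^ k₀) ^ E * T ^ critExp Q p s x := by
      calc (1 : ℝ) = ((2 : ℝ) ^ k₀) ^ E * ((2 : ℝ) ^ k₀) ^ (-E) := by
            rw [← Real.rpow_add (by positivity), add_neg_cancel, Real.rpow_zero]
        _ ≤ ((2 : ℝ) ^ k₀) ^ E * ((2 : ℝ) ^ k₀) ^ critExp Q p s x := by
            gcongr
            · exact one_le_pow₀ (by norm_num)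
            · exact hEb x
        _ ≤ _ := by
            gcongr ?_ * ?_
            exact Real.rpow_le_rpow_of_nonpos hT0 hTk.le hneg
    calc |u x - u y| ≤ |u x| + |u y| := abs_sub _ _
      _ ≤ M₀ + M₀ := add_le_add (hsup D u H h x hx) (hsup D u H h y hy)
      _ = 2 * M₀ * 1 := by ring
      _ ≤ 2 * M₀ * (((2 : ℝ) ^ k₀) ^ E * T ^ critExp Q p s x) := by gcongr
      _ = M₁ * T ^ critExp Q p s x := by simp only [M₁]; ring
      _ ≤ _ := by gcongr; linarith
  · obtain ⟨k, hk, hk'⟩ := exists_nat_pow_near ((one_le_pow₀ (by norm_num)).trans hTk)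
      (one_lt_two (α := ℝ))
    have hk₀ : k₀ ≤ k :=
      Nat.lt_succ_iff.1 ((pow_lt_pow_iff_right₀ (one_lt_two (α := ℝ))).1 (hTk.trans_lt hk'))
    set t : ℝ := (2 : ℝ) ^ k with ht
    have ht1 : 1 ≤ t := one_le_pow₀ (by norm_num)
    have ht0 : 0 < t := by linarith
    have hexp : ∀ z, t ^ (-(1 / Q z)) ≤ t ^ (-θ) := fun z =>
      Real.rpow_le_rpow_of_exponent_le ht1 (neg_le_neg (hθQ z))
    have hdt : dist x y ≤ t ^ (-(1 / Q x)) := by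
      have e : dist x y = T ^ (-(1 / Q x)) := by
        rw [hT, ← Real.rpow_mul hd.le]
        have := (hQ0 x).ne'
        rw [neg_mul_neg, mul_one_div_cancel this, Real.rpow_one]
      rw [e]
      exact Real.rpow_le_rpow_of_nonpos ht0 hk (by have := hQ0 x; rw [neg_nonpos]; positivity)
    have hxy : dist x y ≤ K' * t ^ (-θ) :=
      (hdt.trans (hexp x)).trans (le_mul_of_one_le_left (by positivity) hK1)
    have hyx : dist y x ≤ K' * t ^ (-θ) := by rwa [dist_comm]
    obtain ⟨n, hn⟩ := pow_unbounded_of_one_lt (max (H x) (H y)) (one_lt_two (α := ℝ))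
    have hn' : (2 : ℝ) ^ n ≤ 2 ^ (k + n) := pow_le_pow_right₀ (by norm_num) (by omega)
    obtain ⟨x', hx', hHx', hdx', hux'⟩ := hchain D u H k₀ h x hx n k hk₀
      (((le_max_left _ _).trans hn.le).trans hn')
    obtain ⟨y', hy', hHy', hdy', huy'⟩ := hchain D u H k₀ h y hy n k hk₀
      (((le_max_right _ _).trans hn.le).trans hn')
    rw [← ht] at hHx' hHy' hdx' hdy'
    have hxx' : dist x x' ≤ K' * t ^ (-θ) := hdx'.trans
      (mul_le_mul hKK (hexp x) (by positivity) (by positivity))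
    have hx'x : dist x' x ≤ K' * t ^ (-θ) := by rwa [dist_comm]
    have hdist : dist x' y' ≤ (K + 1 + K * C₁) * C₁ * t ^ (-(1 / Q x')) := by
      calc dist x' y' ≤ dist x x' + dist x y + dist y y' := by
            rw [dist_comm x x']; exact dist_triangle4 _ _ _ _
        _ ≤ K * t ^ (-(1 / Q x)) + t ^ (-(1 / Q x)) + K * (C₁ * t ^ (-(1 / Q x))) := by
            gcongr
            refine hdy'.trans (mul_le_mul_of_nonneg_left ?_ hK)
            exact rpow_neg_le_of_rpow_le ht0 (h₁ x y t ht1 hxy)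
        _ = (K + 1 + K * C₁) * t ^ (-(1 / Q x)) := by ring
        _ ≤ (K + 1 + K * C₁) * (C₁ * t ^ (-(1 / Q x'))) := by
            gcongr
            exact rpow_neg_le_of_rpow_le ht0 (h₁ x' x t ht1 hx'x)
        _ = _ := by ring
    have hmid : |u x' - u y'| ≤ C₃ * (C₂ * t ^ critExp Q p s x) :=
      (h₃ D u H A k₀ h x' hx' y' hy' t ht1 (by linarith) (by linarith) hdist).trans
        (mul_le_mul_of_nonneg_left (h₂ x' x t ht1 hx'x) hC₃)
    have hleft : |u x - u x'| ≤ C * (S * t ^ critExp Q p s x) :=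
      hux'.trans (mul_le_mul_of_nonneg_left (sum_rpow_le_of_neg hc (hcrit x) k n) hC)
    have hright : |u y' - u y| ≤ C * (S * (C₂ * t ^ critExp Q p s x)) := by
      rw [abs_sub_comm]
      refine (huy'.trans (mul_le_mul_of_nonneg_left (sum_rpow_le_of_neg hc (hcrit y) k n) hC)).trans
        ?_
      gcongr
      exact h₂ y x t ht1 hyx
    have htT : t ^ critExp Q p s x ≤ 2 ^ E * T ^ critExp Q p s x := by
      have hT2 : T / 2 ≤ t := by
        rw [pow_succ] at hk'
        linarith
      calc t ^ critExp Q p s x ≤ (T / 2) ^ critExp Q p s x :=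
            Real.rpow_le_rpow_of_nonpos (by positivity) hT2 hneg
        _ = 2 ^ (-critExp Q p s x) * T ^ critExp Q p s x := by
            rw [Real.div_rpow hT0.le (by norm_num), Real.rpow_neg (by norm_num)]
            field_simp
        _ ≤ _ := by
            gcongr ?_ * _
            exact Real.rpow_le_rpow_of_exponent_le (by norm_num) (by linarith [hEb x])
    calc |u x - u y| ≤ |u x - u x'| + |u x' - u y'| + |u y' - u y| := by
          have h5 := abs_sub_le (u x) (u x') (u y)
          have h6 := abs_sub_le (u x') (u y') (u y)
          linarith
      _ ≤ (C * S + C₃ * C₂ + C * S * C₂) * t ^ critExp Q p s x := by linarith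
      _ ≤ (C * S + C₃ * C₂ + C * S * C₂) * (2 ^ E * T ^ critExp Q p s x) := by gcongr
      _ = M₂ * T ^ critExp Q p s x := by simp only [M₂]; ring
      _ ≤ _ := by gcongr; linarith

/-- A function satisfying a variable Hölder estimate on a dense set has a continuous extension. -/
lemma exists_continuous_extension {D : Set X} (hD : Dense D) {u α : X → ℝ} {c C : ℝ} (hc : 0 < c)
    (hα : ∀ x, c ≤ α x) (hC : 0 < C)
    (h : ∀ x ∈ D, ∀ y ∈ D, |u x - u y| ≤ C * dist x y ^ α x) :
    ∃ v : X → ℝ, Continuous v ∧ ∀ x ∈ D, v x = u x := by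
  have huc : UniformContinuous (fun x : D => u x) := by
    rw [Metric.uniformContinuous_iff]
    intro ε hε
    -- Below distance 1 the variable power is at most the power with the fixed exponent `c`.
    refine ⟨min 1 ((ε / C) ^ (1 / c)), lt_min one_pos (by positivity), fun {x y} hxy => ?_⟩
    have h1 : dist (x : X) y < 1 := hxy.trans_le (min_le_left _ _)
    have h2 : dist (x : X) y < (ε / C) ^ (1 / c) := hxy.trans_le (min_le_right _ _)
    rw [Real.dist_eq]
    calc |u x - u y| ≤ C * dist (x : X) y ^ α x := h x x.2 y y.2
      _ ≤ C * dist (x : X) y ^ c := by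
          gcongr C * ?_
          exact Real.rpow_le_rpow_of_exponent_ge' dist_nonneg h1.le hc.le (hα x)
      _ < C * ((ε / C) ^ (1 / c)) ^ c := by
          gcongr
      _ = ε := by
          rw [← Real.rpow_mul (by positivity), one_div_mul_cancel hc.ne', Real.rpow_one]
          field_simp
  exact ⟨hD.extend (fun x : D => u x), (hD.uniformContinuous_extend huc).continuous,
    fun x hx => hD.extend_of_ind huc ⟨x, hx⟩⟩

end Pointwise

/-! ### Scaling of the modular. -/

section Modular

variable {X : Type*} [MeasurableSpace X] {μ : Measure X}

lemma modular_mono {p : X → ℝ} (hp : ∀ x, 0 ≤ p x) {f g : X → ℝ≥0∞} (h : ∀ x, f x ≤ g x) :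
    modular μ p f ≤ modular μ p g :=
  lintegral_mono fun x => ENNReal.rpow_le_rpow (h x) (hp x)

/-- Functions whose modular is at most `M` have quasi-norm at most a constant. -/
lemma exists_modular_div_le_one (μ : Measure X) {p : X → ℝ} {c : ℝ} (hc : 0 < c)
    (hp : ∀ᵐ x ∂μ, c ≤ p x) (M : ℝ≥0) :
    ∃ L : ℝ≥0, 0 < L ∧ ∀ f : X → ℝ≥0∞, modular μ p f ≤ M →
      modular μ p (fun x => f x / L) ≤ 1 := by
  -- With base at least 1, `(M' ^ (1 / c)) ^ p x ≥ M'` follows from `p x ≥ c`.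
  set M' : ℝ≥0 := max M 1
  have hM' : 1 ≤ M' := le_max_right _ _
  have hL1 : 1 ≤ M' ^ (1 / c) := NNReal.one_le_rpow hM' (by positivity)
  have hL0 : 0 < M' ^ (1 / c) := zero_lt_one.trans_le hL1
  refine ⟨M' ^ (1 / c), hL0, fun f hf => ?_⟩
  have hpt : ∀ᵐ x ∂μ, (f x / ((M' ^ (1 / c) : ℝ≥0) : ℝ≥0∞)) ^ p x ≤ f x ^ p x * (M' : ℝ≥0∞)⁻¹ := by
    filter_upwards [hp] with x hx
    have hpx : 0 ≤ p x := hc.le.trans hx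
    rw [ENNReal.div_rpow_of_nonneg _ _ hpx, div_eq_mul_inv]
    gcongr
    rw [← ENNReal.coe_rpow_of_nonneg _ hpx, ENNReal.coe_le_coe]
    calc M' = (M' ^ (1 / c)) ^ c := by
          rw [← NNReal.rpow_mul, one_div_mul_cancel hc.ne', NNReal.rpow_one]
      _ ≤ _ := NNReal.rpow_le_rpow_of_exponent_le hL1 hx
  calc modular μ p (fun x => f x / ((M' ^ (1 / c) : ℝ≥0) : ℝ≥0∞))
      ≤ ∫⁻ x, f x ^ p x * (M' : ℝ≥0∞)⁻¹ ∂μ := lintegral_mono_ae hpt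
    _ = modular μ p f * (M' : ℝ≥0∞)⁻¹ := lintegral_mul_const' _ _ (by
        rw [ENNReal.inv_ne_top]
        exact_mod_cast (zero_lt_one.trans_le hM').ne')
    _ ≤ M' * (M' : ℝ≥0∞)⁻¹ := by
        gcongr
        exact hf.trans (by exact_mod_cast le_max_left _ _)
    _ ≤ 1 := ENNReal.mul_inv_le_one _

/-- An exponent bounded above turns the scaling into a bounded factor; this recovers membership from
a bound on the scaled function. -/
lemma modular_lt_top_of_div {p : X → ℝ} (hp : ∀ x, 0 < p x) {T : ℝ} (hT : ∀ᵐ x ∂μ, p x ≤ T)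
    {L : ℝ≥0} (hL : 0 < L) {f : X → ℝ≥0∞} (hf : modular μ p (fun x => f x / L) < ∞) :
    modular μ p f < ∞ := by
  set L' : ℝ≥0 := max L 1
  have hL' : 1 ≤ L' := le_max_right _ _
  have hpt : ∀ᵐ x ∂μ, f x ^ p x ≤ ((L' ^ T : ℝ≥0) : ℝ≥0∞) * (f x / L) ^ p x := by
    filter_upwards [hT] with x hx
    have h1 : f x = L * (f x / L) :=
      (ENNReal.mul_div_cancel (by exact_mod_cast hL.ne') ENNReal.coe_ne_top).symm
    calc f x ^ p x = (L : ℝ≥0∞) ^ p x * (f x / L) ^ p x := by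
          rw [← ENNReal.mul_rpow_of_nonneg _ _ (hp x).le, ← h1]
      _ ≤ _ := by
          gcongr
          rw [← ENNReal.coe_rpow_of_nonneg _ (hp x).le, ENNReal.coe_le_coe]
          exact (NNReal.rpow_le_rpow (le_max_left _ _) (hp x).le).trans
            (NNReal.rpow_le_rpow_of_exponent_le hL' hx)
  refine (lintegral_mono_ae hpt).trans_lt ?_
  rw [lintegral_const_mul' _ _ ENNReal.coe_ne_top]
  exact ENNReal.mul_lt_top ENNReal.coe_lt_top hf

end Modular

/-! ### From measure and integrability to the embeddings. -/

section Measure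

variable {X : Type*} [MetricSpace X] [MeasurableSpace X] {μ : Measure X}

lemma IsMetricMeasure.isOpenPosMeasure (hμ : IsMetricMeasure μ) : μ.IsOpenPosMeasure := by
  refine ⟨fun U hU hne h0 => ?_⟩
  obtain ⟨x, hx⟩ := hne
  obtain ⟨r, hr, hsub⟩ := Metric.isOpen_iff.1 hU x hx
  exact (hμ x r hr).1.ne' (measure_mono_null hsub h0)

/-- A set of full measure is dense when open sets have positive measure. Essential bounds and gaps
of continuous exponents thereby hold at every point. -/
lemma forall_of_ae_of_isClosed {Y : Type*} [TopologicalSpace Y] [MeasurableSpace Y]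
    {ν : Measure Y} [ν.IsOpenPosMeasure] {P : Y → Prop} (hP : IsClosed {x | P x})
    (h : ∀ᵐ x ∂ν, P x) (x : Y) : P x :=
  hP.closure_subset (Measure.dense_of_ae h x)

lemma LogExponent.continuous {p : X → ℝ} (hp : LogExponent μ p) : Continuous p := by
  have := hp.2.continuous.inv₀ (fun x => (one_div_pos.2 (hp.1.2.1 x)).ne')
  have e : (fun x => 1 / p x)⁻¹ = p := by
    funext x
    simp
  rwa [e] at this

lemma LogExponent.uniformLogExponent [μ.IsOpenPosMeasure] {p : X → ℝ} (hp : LogExponent μ p) :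
    UniformLogExponent p := by
  have hc := hp.continuous
  obtain ⟨⟨_, _, ⟨c, hc0, hcp⟩, ⟨C, hCp⟩⟩, hL⟩ := hp
  exact ⟨hL, c, C, hc0, fun x =>
    ⟨forall_of_ae_of_isClosed (isClosed_le continuous_const hc) hcp x,
      forall_of_ae_of_isClosed (isClosed_le hc continuous_const) hCp x⟩⟩

/-- A bound linear in all admissible scaling factors is a bound by the norm. -/
lemma le_mul_hajlaszNorm {s p u : X → ℝ} {a : ℝ≥0∞} {L : ℝ≥0} (hL : 0 < L)
    (h : ∀ l₁ : ℝ≥0, 0 < l₁ → modular μ p (fun x => ‖u x‖ₑ / (l₁ : ℝ≥0∞)) ≤ 1 →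
      ∀ g : X → ℝ≥0∞, AEMeasurable g μ → IsScalarGradient μ s u g →
      ∀ l₂ : ℝ≥0, 0 < l₂ → modular μ p (fun x => g x / (l₂ : ℝ≥0∞)) ≤ 1 →
        a ≤ L * ((l₁ : ℝ≥0∞) + l₂)) :
    a ≤ L * hajlaszNorm μ s p u := by
  have hL0 : (L : ℝ≥0∞) ≠ 0 := by exact_mod_cast hL.ne'
  simp only [hajlaszNorm, varLNorm, hajlaszSeminorm, luxNorm]
  rw [mul_comm, ← ENNReal.div_le_iff_le_mul (Or.inl hL0) (Or.inl ENNReal.coe_ne_top)]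
  simp only [ENNReal.iInf_add, ENNReal.add_iInf]
  refine le_iInf fun g => le_iInf fun hg => le_iInf fun hgrad => le_iInf fun l₂ =>
    le_iInf fun h₂ => le_iInf fun hgl => le_iInf fun l₁ => le_iInf fun h₁ => le_iInf fun hu => ?_
  rw [ENNReal.div_le_iff_le_mul (Or.inl hL0) (Or.inl ENNReal.coe_ne_top), mul_comm]
  exact h l₁ h₁ hu g hg hgrad l₂ h₂ hgl

lemma MemHajlasz.exists_scaled {s p u : X → ℝ} {c : ℝ} (hc : 0 < c) (hp : ∀ᵐ x ∂μ, c ≤ p x)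
    (hu : MemHajlasz μ s p u) :
    ∃ l₁ : ℝ≥0, 0 < l₁ ∧ modular μ p (fun x => ‖u x‖ₑ / (l₁ : ℝ≥0∞)) ≤ 1 ∧
      ∃ g : X → ℝ≥0∞, AEMeasurable g μ ∧ IsScalarGradient μ s u g ∧
      ∃ l₂ : ℝ≥0, 0 < l₂ ∧ modular μ p (fun x => g x / (l₂ : ℝ≥0∞)) ≤ 1 := by
  obtain ⟨⟨hum, hmod⟩, hsem⟩ := hu
  lift modular μ p (fun x => ‖u x‖ₑ) to ℝ≥0 using hmod.ne with M hM
  obtain ⟨L, hL, hLM⟩ := exists_modular_div_le_one μ hc hp M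
  simp only [hajlaszSeminorm, luxNorm, iInf_lt_iff] at hsem
  obtain ⟨g, hg, hgrad, l₂, h₂, hgl, -⟩ := hsem
  exact ⟨L, hL, hLM _ hM.ge, g, hg, hgrad, l₂, h₂, hgl⟩

lemma le_toReal_rpow_of_rpow_le {a E : ℝ≥0∞} {p : ℝ} (hp : 0 < p) (h : a ^ p ≤ E) (hE : E ≠ ∞) :
    a.toReal ≤ E.toReal ^ (1 / p) := by
  rw [ENNReal.toReal_rpow, one_div]
  exact ENNReal.toReal_mono (ENNReal.rpow_ne_top_of_nonneg (by positivity) hE)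
    ((ENNReal.le_rpow_inv_iff hp).2 h)

/-- After scaling, a function with a gradient satisfies the pointwise hypotheses off a null set. -/
theorem exists_hasDenseSublevels [OpensMeasurableSpace X] {Q p s : X → ℝ}
    (hQ : UniformLogExponent Q) (hp : UniformLogExponent p) (hpm : Measurable p)
    {δ b : ℝ} (hδ : 0 < δ) (hb : 0 < b)
    (hlow : ∀ (x : X) (r : ℝ), 0 < r → r ≤ δ → ENNReal.ofReal (b * r ^ Q x) ≤ μ (ball x r)) :
    ∃ (A : ℝ) (k₀ : ℕ), ∀ (u : X → ℝ), AEMeasurable u μ →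
      ∀ l₁ : ℝ≥0, 0 < l₁ → modular μ p (fun x => ‖u x‖ₑ / (l₁ : ℝ≥0∞)) ≤ 1 →
      ∀ g : X → ℝ≥0∞, AEMeasurable g μ → IsScalarGradient μ s u g →
      ∀ l₂ : ℝ≥0, 0 < l₂ → modular μ p (fun x => g x / (l₂ : ℝ≥0∞)) ≤ 1 →
      ∃ (D : Set X) (E : X → ℝ≥0∞), (∀ᵐ x ∂μ, x ∈ D) ∧ (∀ x ∈ D, E x ≠ ∞) ∧
        ∫⁻ x, E x ∂μ ≤ 2 ∧
        HasDenseSublevels D Q p s (fun x => u x / ((l₁ : ℝ) + l₂)) (fun x => (E x).toReal) A k₀ := by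
  rcases isEmpty_or_nonempty X with hX | ⟨⟨x₀⟩⟩
  · refine ⟨0, 0, fun u _ l₁ _ _ g _ _ l₂ _ _ => ⟨∅, 0, ?_, by simp, by simp, ?_⟩⟩
    · exact Filter.Eventually.of_forall fun x => (hX.false x).elim
    · exact ⟨fun x => (hX.false x).elim, fun x => (hX.false x).elim, fun x => (hX.false x).elim,
        fun x => (hX.false x).elim⟩
  have hQ0 := hQ.pos
  have hp0 := hp.pos
  obtain ⟨-, cQ, CQ, hcQ, hQb⟩ := hQ
  have hCQ : 0 < CQ := (hQ0 x₀).trans_le (hQb x₀).2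
  -- This gives `b * a ≥ 3`, which beats the bound 2 on the integral of `E`. The level `k₀` below is
  -- such that the radii `(a / 2 ^ k) ^ (1 / Q x)` do not exceed `δ` for `k ≥ k₀`.
  set a : ℝ := max (3 / b) 1
  have ha1 : 1 ≤ a := le_max_right _ _
  set A : ℝ := a ^ (1 / cQ)
  obtain ⟨k₀, hk₀⟩ : ∃ k₀ : ℕ, a ≤ 2 ^ k₀ * min δ 1 ^ CQ := by
    obtain ⟨k, hk⟩ := pow_unbounded_of_one_lt (a / min δ 1 ^ CQ) (one_lt_two (α := ℝ))
    have : 0 < min δ 1 ^ CQ := Real.rpow_pos_of_pos (lt_min hδ one_pos) _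
    exact ⟨k, ((div_lt_iff₀ this).1 hk).le⟩
  refine ⟨A, k₀, fun u hu l₁ hl₁ hul g hg hgrad l₂ hl₂ hgl => ?_⟩
  obtain ⟨N, hN, hgN⟩ := hgrad
  set l : ℝ≥0 := l₁ + l₂ with hl
  have hl0 : 0 < l := by positivity
  have hlR : (0 : ℝ) < l := by exact_mod_cast hl0
  have hlE : (l : ℝ≥0∞) ≠ 0 := by exact_mod_cast hl0.ne'
  set E : X → ℝ≥0∞ := fun x => (‖u x‖ₑ / (l : ℝ≥0∞)) ^ p x + (g x / (l : ℝ≥0∞)) ^ p x with hE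
  have hm1 : AEMeasurable (fun x => (‖u x‖ₑ / (l : ℝ≥0∞)) ^ p x) μ :=
    (hu.enorm.div_const _).pow hpm.aemeasurable
  have hm2 : AEMeasurable (fun x => (g x / (l : ℝ≥0∞)) ^ p x) μ :=
    (hg.div_const _).pow hpm.aemeasurable
  have hEm : AEMeasurable E μ := hm1.add hm2
  have hE2 : ∫⁻ x, E x ∂μ ≤ 2 := by
    rw [hE, lintegral_add_left' hm1, ← one_add_one_eq_two]
    refine add_le_add (le_trans ?_ hul) (le_trans ?_ hgl)
    · refine modular_mono (fun x => (hp0 x).le) fun x => ?_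
      gcongr
      exact le_self_add
    · refine modular_mono (fun x => (hp0 x).le) fun x => ?_
      gcongr
      exact le_add_self
  set D : Set X := {x | x ∉ N ∧ E x < ∞} with hD
  have hDae : ∀ᵐ x ∂μ, x ∈ D := by
    have h1 : ∀ᵐ x ∂μ, x ∉ N := measure_eq_zero_iff_ae_notMem.1 hN
    have h2 : ∀ᵐ x ∂μ, E x < ∞ := ae_lt_top' hEm (hE2.trans_lt (by norm_num)).ne
    filter_upwards [h1, h2] with x hx hx' using ⟨hx, hx'⟩
  refine ⟨D, E, hDae, fun x hx => hx.2.ne, hE2, fun x => ENNReal.toReal_nonneg, ?_, ?_, ?_⟩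
  · intro x hx y hy
    have hfin : ∀ z ∈ D, g z ≠ ∞ := by
      intro z hz htop
      refine hz.2.ne ?_
      simp only [hE, htop]
      rw [ENNReal.top_div_of_ne_top ENNReal.coe_ne_top, ENNReal.top_rpow_of_pos (hp0 z), add_top]
    have hgz : ∀ z ∈ D, (g z).toReal / l ≤ (E z).toReal ^ (1 / p z) := by
      intro z hz
      have := le_toReal_rpow_of_rpow_le (hp0 z) (le_add_self : _ ≤ E z) hz.2.ne
      rwa [ENNReal.toReal_div, ENNReal.coe_toReal] at this
    have h1 := hgN x hx.1 y hy.1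
    rw [← ENNReal.ofReal_toReal (hfin x hx), ← ENNReal.ofReal_toReal (hfin y hy),
      ← ENNReal.ofReal_mul (by positivity), ← ENNReal.ofReal_mul (by positivity),
      ← ENNReal.ofReal_add (by positivity) (by positivity),
      ENNReal.ofReal_le_ofReal_iff (by positivity)] at h1
    have hlc : (l : ℝ) = (l₁ : ℝ) + l₂ := by simp [hl]
    rw [← hlc, ← sub_div, abs_div, abs_of_pos hlR]
    calc |u x - u y| / l
        ≤ (dist x y ^ s x * (g x).toReal + dist x y ^ s y * (g y).toReal) / l := by gcongr
      _ = dist x y ^ s x * ((g x).toReal / l) + dist x y ^ s y * ((g y).toReal / l) := by ring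
      _ ≤ _ := add_le_add (mul_le_mul_of_nonneg_left (hgz x hx) (by positivity))
          (mul_le_mul_of_nonneg_left (hgz y hy) (by positivity))
  · intro x hx
    have := le_toReal_rpow_of_rpow_le (hp0 x) (le_self_add : _ ≤ E x) hx.2.ne
    rw [ENNReal.toReal_div, ENNReal.coe_toReal, toReal_enorm, Real.norm_eq_abs] at this
    have hlc : (l : ℝ) = (l₁ : ℝ) + l₂ := by simp [hl]
    rwa [← hlc, abs_div, abs_of_pos hlR]
  · intro x k hk
    set r : ℝ := (a / 2 ^ k) ^ (1 / Q x) with hr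
    have hr0 : 0 < r := by positivity
    have hrA : r ≤ A * ((2 : ℝ) ^ k) ^ (-(1 / Q x)) := by
      rw [hr, Real.div_rpow (by positivity) (by positivity), Real.rpow_neg (by positivity),
        div_eq_mul_inv]
      gcongr ?_ * _
      exact Real.rpow_le_rpow_of_exponent_le ha1 (one_div_le_one_div_of_le hcQ (hQb x).1)
    have hrQ : r ^ Q x = a / 2 ^ k := by
      rw [hr, ← Real.rpow_mul (by positivity), one_div_mul_cancel (hQ0 x).ne', Real.rpow_one]
    have hrδ : r ≤ δ := by
      refine le_trans ?_ (min_le_left δ 1)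
      have hm : 0 < min δ 1 := lt_min hδ one_pos
      rw [← Real.rpow_le_rpow_iff hr0.le hm.le (hQ0 x), hrQ, div_le_iff₀ (by positivity), mul_comm]
      calc a ≤ 2 ^ k₀ * min δ 1 ^ CQ := hk₀
        _ ≤ 2 ^ k * min δ 1 ^ Q x := by
          refine mul_le_mul (pow_le_pow_right₀ (by norm_num) hk) ?_ (by positivity) (by positivity)
          exact Real.rpow_le_rpow_of_exponent_ge hm (min_le_right _ _) (hQb x).2
    -- Otherwise the ball lies, up to a null set, in `{E ≥ 2 ^ k}`, and Chebyshev contradicts the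
    -- lower mass bound.
    by_contra! hcon
    have hsub : ball x r ⊆ Dᶜ ∪ {y | (2 : ℝ≥0∞) ^ k ≤ E y} := by
      intro y hy
      by_cases hyD : y ∈ D
      · right
        have h1 := hcon y hyD (((mem_ball'.1 hy).le).trans hrA)
        have h2 := ENNReal.ofReal_le_ofReal h1.le
        rw [ENNReal.ofReal_toReal hyD.2.ne, ENNReal.ofReal_pow (by norm_num)] at h2
        simpa using h2
      · exact Or.inl hyD
    have h1 : μ (ball x r) ≤ ENNReal.ofReal (2 / 2 ^ k) := by
      calc μ (ball x r) ≤ μ Dᶜ + μ {y | (2 : ℝ≥0∞) ^ k ≤ E y} :=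
            (measure_mono hsub).trans (measure_union_le _ _)
        _ = μ {y | (2 : ℝ≥0∞) ^ k ≤ E y} := by
            rw [show μ Dᶜ = 0 from hDae, zero_add]
        _ ≤ (∫⁻ y, E y ∂μ) / 2 ^ k := meas_ge_le_lintegral_div hEm (by simp) (by simp)
        _ ≤ 2 / 2 ^ k := by gcongr
        _ = _ := by
            rw [ENNReal.ofReal_div_of_pos (by positivity), ENNReal.ofReal_pow (by norm_num)]
            simp
    have h2 := (hlow x r hr0 hrδ).trans h1
    rw [ENNReal.ofReal_le_ofReal_iff (by positivity), hrQ] at h2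
    have h3 : 3 ≤ b * a := by
      have : 3 / b ≤ a := le_max_left _ _
      rw [div_le_iff₀ hb] at this
      linarith
    rw [← mul_div_assoc, div_le_div_iff_of_pos_right (by positivity)] at h2
    linarith

/-- The Sobolev embedding, in the subcritical and critical cases at once. The pointwise bound
`|u| ^ τ ≤ C H` with `H` integrable makes any doubling or covering assumption unnecessary. -/
theorem embedsInVarL_of_critExp_le [OpensMeasurableSpace X] {Q p s τ : X → ℝ}
    (hQ : UniformLogExponent Q) (hp : UniformLogExponent p) (hpm : Measurable p)
    (hs : UniformLogExponent s) {δ b : ℝ} (hδ : 0 < δ) (hb : 0 < b)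
    (hlow : ∀ (x : X) (r : ℝ), 0 < r → r ≤ δ → ENNReal.ofReal (b * r ^ Q x) ≤ μ (ball x r))
    (hτ : BoundedExponent μ τ) (hpτ : ∀ᵐ x ∂μ, p x ≤ τ x)
    (hcrit : ∀ᵐ x ∂μ, critExp Q p s x ≤ 1 / τ x) : EmbedsInVarL μ s p τ := by
  obtain ⟨A, k₀, hdense⟩ := exists_hasDenseSublevels (s := s) hQ hp hpm hδ hb hlow
  obtain ⟨-, hτ0, ⟨cτ, hcτ, hcτb⟩, T, hT⟩ := hτ
  obtain ⟨C, hC, hpt⟩ := abs_rpow_le_of_critExp_le hQ hp hs A k₀ T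
  obtain ⟨-, cp, Cp, hcp, hpb⟩ := hp
  obtain ⟨L, hL, hLm⟩ := exists_modular_div_le_one μ hcτ hcτb (C.toNNReal * 2)
  have key : ∀ (u : X → ℝ), AEMeasurable u μ →
      ∀ l₁ : ℝ≥0, 0 < l₁ → modular μ p (fun x => ‖u x‖ₑ / (l₁ : ℝ≥0∞)) ≤ 1 →
      ∀ g : X → ℝ≥0∞, AEMeasurable g μ → IsScalarGradient μ s u g →
      ∀ l₂ : ℝ≥0, 0 < l₂ → modular μ p (fun x => g x / (l₂ : ℝ≥0∞)) ≤ 1 →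
      modular μ τ (fun x => ‖u x‖ₑ / ((L * (l₁ + l₂) : ℝ≥0) : ℝ≥0∞)) ≤ 1 := by
    intro u hu l₁ hl₁ hul g hg hgrad l₂ hl₂ hgl
    obtain ⟨D, E, hD, hDE, hE, h⟩ := hdense u hu l₁ hl₁ hul g hg hgrad l₂ hl₂ hgl
    have hl0 : (0 : ℝ) < (l₁ : ℝ) + l₂ := by positivity
    have hmod : modular μ τ (fun x => ‖u x / ((l₁ : ℝ) + l₂)‖ₑ) ≤ (C.toNNReal * 2 : ℝ≥0) := by
      calc modular μ τ (fun x => ‖u x / ((l₁ : ℝ) + l₂)‖ₑ)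
          ≤ ∫⁻ x, C.toNNReal * E x ∂μ := by
            refine lintegral_mono_ae ?_
            filter_upwards [hD, hpτ, hcrit, hT] with x hx h1 h2 h3
            have h4 := hpt D _ _ h x hx (τ x) h1 h3 h2
            rw [Real.enorm_eq_ofReal_abs, ENNReal.ofReal_rpow_of_nonneg (abs_nonneg _) (hτ0 x).le]
            refine (ENNReal.ofReal_le_ofReal h4).trans ?_
            rw [ENNReal.ofReal_mul (by linarith), ENNReal.ofReal_toReal (hDE x hx)]
            rfl
        _ = C.toNNReal * ∫⁻ x, E x ∂μ := lintegral_const_mul' _ _ ENNReal.coe_ne_top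
        _ ≤ C.toNNReal * 2 := by gcongr
        _ = _ := by simp
    refine le_of_eq_of_le ?_ (hLm _ hmod)
    congr 1
    funext x
    have e : ‖u x / ((l₁ : ℝ) + l₂)‖ₑ = ‖u x‖ₑ / ((l₁ + l₂ : ℝ≥0) : ℝ≥0∞) := by
      rw [Real.enorm_eq_ofReal_abs, Real.enorm_eq_ofReal_abs, abs_div, abs_of_pos hl0,
        ENNReal.ofReal_div_of_pos hl0, ← NNReal.coe_add, ENNReal.ofReal_coe_nnreal]
    rw [e, mul_comm L, ENNReal.coe_mul, div_eq_mul_inv, div_eq_mul_inv, div_eq_mul_inv, mul_assoc,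
      ENNReal.mul_inv (Or.inr ENNReal.coe_ne_top) (Or.inl ENNReal.coe_ne_top)]
  refine ⟨L, fun u hu => ⟨⟨hu.1.1, ?_⟩, ?_⟩⟩
  · obtain ⟨l₁, hl₁, hul, g, hg, hgrad, l₂, hl₂, hgl⟩ :=
      hu.exists_scaled hcp (Filter.Eventually.of_forall fun x => (hpb x).1)
    exact modular_lt_top_of_div hτ0 hT (by positivity)
      ((key u hu.1.1 l₁ hl₁ hul g hg hgrad l₂ hl₂ hgl).trans_lt ENNReal.one_lt_top)
  · refine le_mul_hajlaszNorm hL fun l₁ hl₁ hul g hg hgrad l₂ hl₂ hgl => ?_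
    have h0 : 0 < L * (l₁ + l₂) := by positivity
    refine (iInf_le_of_le (L * (l₁ + l₂)) (iInf_le_of_le h0 (iInf_le_of_le
      (key u hu.1.1 l₁ hl₁ hul g hg hgrad l₂ hl₂ hgl) le_rfl))).trans_eq ?_
    push_cast
    rfl

/-- The Morrey embedding. -/
theorem embedsInHolder_of_critExp_le_neg [OpensMeasurableSpace X] [μ.IsOpenPosMeasure]
    {Q p s : X → ℝ} (hQ : UniformLogExponent Q) (hp : UniformLogExponent p) (hpm : Measurable p)
    (hs : UniformLogExponent s) {δ b : ℝ} (hδ : 0 < δ) (hb : 0 < b)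
    (hlow : ∀ (x : X) (r : ℝ), 0 < r → r ≤ δ → ENNReal.ofReal (b * r ^ Q x) ≤ μ (ball x r))
    {c : ℝ} (hc : 0 < c) (hcrit : ∀ x, critExp Q p s x ≤ -c) :
    EmbedsInHolder μ s p (fun x => -Q x * critExp Q p s x) := by
  obtain ⟨A, k₀, hdense⟩ := exists_hasDenseSublevels (s := s) hQ hp hpm hδ hb hlow
  obtain ⟨C, hC, hpt⟩ := abs_sub_le_of_critExp_le_neg hQ hp hs A k₀ hc hcrit
  have hcont : Continuous (fun x => -Q x * critExp Q p s x) :=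
    hQ.logHolder.continuous.neg.mul (hQ.logHolder_critExp hp hs).continuous
  obtain ⟨-, cp, Cp, hcp, hpb⟩ := hp
  obtain ⟨-, cQ, CQ, hcQ, hQb⟩ := hQ
  set α : X → ℝ := fun x => -Q x * critExp Q p s x with hαdef
  -- The positive lower bound gives both uniform continuity on `D` and continuity of `dist ^ α`
  -- across the diagonal.
  have hα : ∀ x, cQ * c ≤ α x := by
    intro x
    have h1 := (hQb x).1
    have h2 := hcrit x
    simp only [hαdef]
    nlinarith
  have hα0 : ∀ x, 0 < α x := fun x => lt_of_lt_of_le (by positivity) (hα x)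
  have key : ∀ (u : X → ℝ), AEMeasurable u μ →
      ∀ l₁ : ℝ≥0, 0 < l₁ → modular μ p (fun x => ‖u x‖ₑ / (l₁ : ℝ≥0∞)) ≤ 1 →
      ∀ g : X → ℝ≥0∞, AEMeasurable g μ → IsScalarGradient μ s u g →
      ∀ l₂ : ℝ≥0, 0 < l₂ → modular μ p (fun x => g x / (l₂ : ℝ≥0∞)) ≤ 1 →
      ∃ D : Set X, (∀ᵐ x ∂μ, x ∈ D) ∧ ∀ x ∈ D, |u x| ≤ C * ((l₁ : ℝ) + l₂) ∧
        ∀ y ∈ D, |u x - u y| ≤ C * ((l₁ : ℝ) + l₂) * dist x y ^ α x := by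
    intro u hu l₁ hl₁ hul g hg hgrad l₂ hl₂ hgl
    obtain ⟨D, E, hD, hDE, hE, h⟩ := hdense u hu l₁ hl₁ hul g hg hgrad l₂ hl₂ hgl
    have hl0 : (0 : ℝ) < (l₁ : ℝ) + l₂ := by positivity
    refine ⟨D, hD, fun x hx => ?_⟩
    obtain ⟨h1, h2⟩ := hpt D _ _ h x hx
    constructor
    · rwa [abs_div, abs_of_pos hl0, div_le_iff₀ hl0] at h1
    · intro y hy
      have h3 := h2 y hy
      rw [← sub_div, abs_div, abs_of_pos hl0, div_le_iff₀ hl0] at h3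
      linarith
  refine ⟨(2 * C).toNNReal, fun u hu => ?_⟩
  -- The good set `D` varies with the gradient and the scalings, but `v` does not; stating the bound
  -- for all of them with one `v` permits passing to the infimum.
  have hnorm : ∀ v : X → ℝ, Continuous v → u =ᵐ[μ] v →
      ∀ l₁ : ℝ≥0, 0 < l₁ → modular μ p (fun x => ‖u x‖ₑ / (l₁ : ℝ≥0∞)) ≤ 1 →
      ∀ g : X → ℝ≥0∞, AEMeasurable g μ → IsScalarGradient μ s u g →
      ∀ l₂ : ℝ≥0, 0 < l₂ → modular μ p (fun x => g x / (l₂ : ℝ≥0∞)) ≤ 1 →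
      holderNorm α v ≤ ((2 * C).toNNReal : ℝ≥0∞) * ((l₁ : ℝ≥0∞) + l₂) := by
    intro v hv huv l₁ hl₁ hul g hg hgrad l₂ hl₂ hgl
    obtain ⟨D, hD, hDb⟩ := key u hu.1.1 l₁ hl₁ hul g hg hgrad l₂ hl₂ hgl
    set M : ℝ := C * ((l₁ : ℝ) + l₂) with hM
    have hM0 : 0 ≤ M := by positivity
    have hD' : Dense {x | x ∈ D ∧ u x = v x} := Measure.dense_of_ae (hD.and huv)
    have hsup : ∀ x, |v x| ≤ M := by
      have hcl : IsClosed {x | |v x| ≤ M} := isClosed_le hv.abs continuous_const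
      intro x
      have hsub : {x | x ∈ D ∧ u x = v x} ⊆ {x | |v x| ≤ M} := by
        rintro y ⟨hy, hyv⟩
        change |v y| ≤ M
        rw [← hyv]
        exact (hDb y hy).1
      exact hcl.closure_subset_iff.2 hsub (hD' x)
    have hhol : ∀ z : X × X, |v z.1 - v z.2| ≤ M * dist z.1 z.2 ^ α z.1 := by
      have hcl : IsClosed {z : X × X | |v z.1 - v z.2| ≤ M * dist z.1 z.2 ^ α z.1} := by
        refine isClosed_le ((hv.comp continuous_fst).sub (hv.comp continuous_snd)).abs
          (continuous_const.mul ?_)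
        exact (continuous_fst.dist continuous_snd).rpow (hcont.comp continuous_fst)
          fun z => Or.inr (hα0 z.1)
      intro z
      have hsub : {x | x ∈ D ∧ u x = v x} ×ˢ {x | x ∈ D ∧ u x = v x} ⊆
          {z : X × X | |v z.1 - v z.2| ≤ M * dist z.1 z.2 ^ α z.1} := by
        rintro ⟨x, y⟩ ⟨⟨hx, hxv⟩, ⟨hy, hyv⟩⟩
        change |v x - v y| ≤ M * dist x y ^ α x
        rw [← hxv, ← hyv]
        exact (hDb x hx).2 y hy
      exact hcl.closure_subset_iff.2 hsub (hD'.prod hD' z)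
    have h1 : supNorm v ≤ ENNReal.ofReal M := iSup_le fun x => by
      rw [Real.enorm_eq_ofReal_abs]
      exact ENNReal.ofReal_le_ofReal (hsup x)
    have h2 : holderSeminorm α v ≤ ENNReal.ofReal M :=
      iSup_le fun x => iSup_le fun y => iSup_le fun hne => by
        refine ENNReal.ofReal_le_ofReal ?_
        rw [div_le_iff₀ (Real.rpow_pos_of_pos (dist_pos.2 hne) _)]
        exact hhol (x, y)
    calc holderNorm α v ≤ ENNReal.ofReal M + ENNReal.ofReal M := add_le_add h1 h2
      _ = ENNReal.ofReal (2 * C) * ENNReal.ofReal ((l₁ : ℝ) + l₂) := by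
          rw [← ENNReal.ofReal_add hM0 hM0, ← ENNReal.ofReal_mul (by positivity)]
          congr 1
          rw [hM]; ring
      _ = _ := by
          rw [ENNReal.ofReal_add (by positivity) (by positivity), ENNReal.ofReal_coe_nnreal,
            ENNReal.ofReal_coe_nnreal]
          rfl
  obtain ⟨l₁, hl₁, hul, g, hg, hgrad, l₂, hl₂, hgl⟩ :=
    hu.exists_scaled hcp (Filter.Eventually.of_forall fun x => (hpb x).1)
  obtain ⟨D, hD, hDb⟩ := key u hu.1.1 l₁ hl₁ hul g hg hgrad l₂ hl₂ hgl
  obtain ⟨v, hv, hvu⟩ := exists_continuous_extension (Measure.dense_of_ae hD) (u := u)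
    (mul_pos hcQ hc) hα (C := C * ((l₁ : ℝ) + l₂)) (by positivity) fun x hx y hy => (hDb x hx).2 y hy
  have huv : u =ᵐ[μ] v := by
    filter_upwards [hD] with x hx using (hvu x hx).symm
  have hfin : holderNorm α v < ∞ :=
    (hnorm v hv huv l₁ hl₁ hul g hg hgrad l₂ hl₂ hgl).trans_lt
      (ENNReal.mul_lt_top ENNReal.coe_lt_top (by simp))
  exact ⟨v, huv, ⟨hv, le_self_add.trans_lt hfin, le_add_self.trans_lt hfin⟩,
    le_mul_hajlaszNorm (by simpa using hC) (hnorm v hv huv)⟩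

end Measure

end VarHajlasz

/-! ### The three regimes expressed through `critExp`. -/

theorem mainTheorem2 {X : Type*} [MetricSpace X] [MeasurableSpace X] [BorelSpace X]
    (μ : Measure X) (hμ : VarHajlasz.IsMetricMeasure μ)
    (Q : X → ℝ) (hQ : VarHajlasz.LogExponent μ Q)
    (δ b : ℝ) (hδ : 0 < δ) (hb : 0 < b) (hb1 : b ≤ 1)
    (hlow : ∀ (x : X) (r : ℝ), 0 < r → r ≤ δ → ENNReal.ofReal (b * r ^ Q x) ≤ μ (ball x r)) :
    (VarHajlasz.GeometricallyDoubling X → (⨆ x : X, μ (ball x δ)) < ∞ →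
      ∀ p s : X → ℝ, VarHajlasz.LogExponent μ p → VarHajlasz.LogExponent μ s →
        VarHajlasz.EssGT μ Q (fun x => s x * p x) →
        VarHajlasz.BoundedExponent μ (fun x => Q x * p x / (Q x - s x * p x)) ∧
        VarHajlasz.EmbedsInVarL μ s p (fun x => Q x * p x / (Q x - s x * p x))) ∧
    (VarHajlasz.GeometricallyDoubling X → (⨆ x : X, μ (ball x δ)) < ∞ →
      ∀ p s : X → ℝ, VarHajlasz.LogExponent μ p → VarHajlasz.LogExponent μ s →
        (∀ x, s x * p x = Q x) →
        ∀ β : X → ℝ, VarHajlasz.BoundedExponent μ β → VarHajlasz.EssGT μ β p →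
          VarHajlasz.EmbedsInVarL μ s p β) ∧
    (∀ p s : X → ℝ, VarHajlasz.LogExponent μ p → VarHajlasz.LogExponent μ s →
        VarHajlasz.EssGT μ (fun x => s x * p x) Q →
        (∃ A : ℝ, ∀ x, 0 ≤ s x - Q x / p x ∧ s x - Q x / p x ≤ A) ∧
        VarHajlasz.EmbedsInHolder μ s p (fun x => s x - Q x / p x)) := by
  have := hμ.isOpenPosMeasure
  have hQu := hQ.uniformLogExponent
  have hQ0 := hQu.pos
  obtain ⟨cQ, CQ, hcQ, hQb⟩ := hQu.2
  refine ⟨fun _ _ p s hp hs hgt => ?_, fun _ _ p s hp hs heq β hβ hβp => ?_,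
    fun p s hp hs hgt => ?_⟩
  · have hpu := hp.uniformLogExponent
    have hsu := hs.uniformLogExponent
    have hp0 := hpu.pos
    have hs0 := hsu.pos
    obtain ⟨cp, Cp, hcp, hpb⟩ := hpu.2
    obtain ⟨c, hc, hcae⟩ := hgt
    have hgap : ∀ x, c ≤ Q x - s x * p x := VarHajlasz.forall_of_ae_of_isClosed
      (isClosed_le continuous_const (hQ.continuous.sub (hs.continuous.mul hp.continuous))) hcae
    have hgap0 : ∀ x, 0 < Q x - s x * p x := fun x => hc.trans_le (hgap x)
    -- Dividing by `Q - s p < Q` only increases; this also supplies the lower bound for the Sobolev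
    -- exponent.
    have hle : ∀ x, p x ≤ Q x * p x / (Q x - s x * p x) := by
      intro x
      rw [le_div_iff₀ (hgap0 x)]
      nlinarith [mul_pos (hs0 x) (hp0 x), hp0 x]
    have hbdd : VarHajlasz.BoundedExponent μ (fun x => Q x * p x / (Q x - s x * p x)) := by
      refine ⟨(hQ.1.1.mul hp.1.1).div (hQ.1.1.sub (hs.1.1.mul hp.1.1)), fun x => ?_,
        ⟨cp, hcp, .of_forall fun x => (hpb x).1.trans (hle x)⟩, CQ * Cp / c, .of_forall fun x => ?_⟩
      · have := hQ0 x
        have := hp0 x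
        have := hgap0 x
        positivity
      · have h1 := (hQ0 x).le.trans (hQb x).2
        have h2 := (hp0 x).le.trans (hpb x).2
        exact div_le_div₀ (by positivity) (mul_le_mul (hQb x).2 (hpb x).2 (hp0 x).le h1) hc (hgap x)
    refine ⟨hbdd, VarHajlasz.embedsInVarL_of_critExp_le hQu hpu hp.1.1 hsu hδ hb hlow hbdd
      (.of_forall hle) (.of_forall fun x => le_of_eq ?_)⟩
    have h1 := (hQ0 x).ne'
    have h2 := (hp0 x).ne'
    rw [VarHajlasz.critExp, one_div_div]
    field_simp
  · have hpu := hp.uniformLogExponent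
    have hsu := hs.uniformLogExponent
    obtain ⟨c, hc, hcae⟩ := hβp
    refine VarHajlasz.embedsInVarL_of_critExp_le hQu hpu hp.1.1 hsu hδ hb hlow hβ ?_
      (.of_forall fun x => ?_)
    · filter_upwards [hcae] with x hx
      linarith
    · have h1 := (hpu.pos x).ne'
      have h2 := (hsu.pos x).ne'
      have h3 : VarHajlasz.critExp Q p s x = 0 := by
        rw [VarHajlasz.critExp, ← heq x]
        field_simp
        ring
      rw [h3]
      exact (one_div_pos.2 (hβ.2.1 x)).le
  · have hpu := hp.uniformLogExponent
    have hsu := hs.uniformLogExponent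
    have hp0 := hpu.pos
    have hs0 := hsu.pos
    obtain ⟨cp, Cp, hcp, hpb⟩ := hpu.2
    obtain ⟨cs, Cs, hcs, hsb⟩ := hsu.2
    obtain ⟨c, hc, hcae⟩ := hgt
    have hgap : ∀ x, c ≤ s x * p x - Q x := VarHajlasz.forall_of_ae_of_isClosed
      (isClosed_le continuous_const ((hs.continuous.mul hp.continuous).sub hQ.continuous)) hcae
    have hα : ∀ x, s x - Q x / p x = (s x * p x - Q x) / p x := by
      intro x
      have := (hp0 x).ne'
      field_simp
    refine ⟨⟨Cs, fun x => ⟨?_, ?_⟩⟩, ?_⟩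
    · rw [hα]
      exact div_nonneg (hc.le.trans (hgap x)) (hp0 x).le
    · have := div_pos (hQ0 x) (hp0 x)
      linarith [(hsb x).2]
    · rcases isEmpty_or_nonempty X with hX | ⟨⟨x₀⟩⟩
      · refine ⟨0, fun u _ => ⟨u, .rfl, ⟨?_, ?_, ?_⟩, ?_⟩⟩
        · exact continuous_of_discreteTopology
        · simp [VarHajlasz.supNorm]
        · simp [VarHajlasz.holderSeminorm]
        · simp [VarHajlasz.holderNorm, VarHajlasz.supNorm, VarHajlasz.holderSeminorm]
      have hCp : 0 < Cp := (hp0 x₀).trans_le (hpb x₀).2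
      have hCQ : 0 < CQ := (hQ0 x₀).trans_le (hQb x₀).2
      have hcrit : ∀ x, VarHajlasz.critExp Q p s x ≤ -(c / (Cp * CQ)) := by
        intro x
        have h1 := hp0 x
        have h2 := hQ0 x
        have e : VarHajlasz.critExp Q p s x = -((s x * p x - Q x) / (p x * Q x)) := by
          rw [VarHajlasz.critExp]
          field_simp
          ring
        rw [e]
        refine neg_le_neg (div_le_div₀ (hc.le.trans (hgap x)) (hgap x) (by positivity) ?_)
        exact mul_le_mul (hpb x).2 (hQb x).2 h2.le hCp.le
      have := VarHajlasz.embedsInHolder_of_critExp_le_neg hQu hpu hp.1.1 hsu hδ hb hlow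
        (by positivity) hcrit
      have e : (fun x => -Q x * VarHajlasz.critExp Q p s x) = fun x => s x - Q x / p x := by
        funext x
        have h1 := (hp0 x).ne'
        have h2 := (hQ0 x).ne'
        rw [VarHajlasz.critExp]
        field_simp
        ring
      rwa [e] at this
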